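/- Model. A quantum word machine with word length $w$ has classical word registers and a fixed finite number of quantum word registers. In one step it performs one of the following: an elementary word operation (constants, $+,-,\times$ modulo $2^w$, bitwise operations, shifts, comparisons, look-up of a coordinate of the $i$-th input point) on classical registers; the same kind of operation reversibly on quantum registers, i.e. in superposition, the result being XORed into a quantum register (for look-ups this is access to the unitary $|i\rangle|z\rangle\mapsto|i\rangle|z\oplus d_i\rangle$ encoding the input); a Hadamard, $Z$ or $T$ gate on one qubit; a measurement of a quantum register in the computational basis; a test on a classical register for branching or looping, a sequencing step, or the output of a word. The running time is the number of steps. A program is a finite text, independent of the input and of $w$. Geometry. Let $S=\{P_0,\dots,P_{m-1}\}$ be a set of $m$ distinct points in the plane with integer coordinates of absolute value less than $2^b$ (in no particular order, with no general-position assumption), and let $p_s,p_f\in S$ be vertices of the convex hull of $S$. The part of the convex hull from $p_s$ to $p_f$ in the clockwise direction is the list of hull vertices met when the boundary is traversed clockwise from $p_s$ until $p_f$ is reached, both included (it is $(p_s)$ if $p_s=p_f$); consecutive vertices $u,v$ of it are distinct and the whole hull lies in the closed half-plane to the right of the directed line $u\to v$. This list exists and is unique; let $h$ be its length. Statement. For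 every $c\in\mathbb N$ there are a program and constants $\kappa,C,k\in\mathbb N$, depending only on $c$, such that for all $m,b$, all word lengths $w\ge\kappa\,(b+\lfloor\log_2 m\rfloor+1)$ and all $S,p_s,p_f$ as above, the program, given $m$, the indices of $p_s$ and $p_f$ and access to the points of $S$, halts after at most $$C\,h\,\sqrt m\,(\ln m+1)^k$$ steps and outputs exactly the indices of the points of the clockwise part of the convex hull from $p_s$ to $p_f$, in clockwise order, with probability at least $1-(m+1)^{-c}$. In particular this part of the hull can be computed in $\tilde O(h\sqrt m)$ time, where $h$, the number of hull points on the part, need not be known in advance. -/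

import Mathlib

/-! ### Planar convex hulls and their clockwise boundary -/

/-- A grid point, seen as a point of the real plane. -/
def toPlane (p : ℤ × ℤ) : ℝ × ℝ := ((p.1 : ℝ), (p.2 : ℝ))

/-- The convex hull in the real plane of the points `P 0, …, P (m - 1)`. -/
def hull {m : ℕ} (P : Fin m → ℤ × ℤ) : Set (ℝ × ℝ) :=
  convexHull ℝ (Set.range fun i => toPlane (P i))

/-- `P i` is a vertex (extreme point) of the convex hull. -/
def IsHullVertex {m : ℕ} (P : Fin m → ℤ × ℤ) (i : Fin m) : Prop :=
  toPlane (P i) ∈ (hull P).extremePoints ℝ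

/-- The cross product `(v - u) × (p - u)`; it is positive, zero or negative according to whether
`p` lies to the left of, on, or to the right of the line directed from `u` to `v`. -/
def turn (u v p : ℝ × ℝ) : ℝ :=
  (v.1 - u.1) * (p.2 - u.2) - (v.2 - u.2) * (p.1 - u.1)

/-- The boundary of the convex hull, traversed clockwise, has an edge from the vertex `P i` to the
vertex `P j`: the whole hull lies in the closed half-plane to the right of this directed edge. -/
def IsClockwiseEdge {m : ℕ} (P : Fin m → ℤ × ℤ) (i j : Fin m) : Prop :=
  i ≠ j ∧ IsHullVertex P i ∧ IsHullVertex P j ∧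
    ∀ p ∈ hull P, turn (toPlane (P i)) (toPlane (P j)) p ≤ 0

/-- `L` lists, in order and without repetition, the hull vertices met when the boundary of the
convex hull is traversed clockwise from the vertex `P s` until the vertex `P f` is reached
(both included). -/
def IsClockwisePart {m : ℕ} (P : Fin m → ℤ × ℤ) (s f : Fin m) (L : List (Fin m)) : Prop :=
  L.head? = some s ∧ L.getLast? = some f ∧ L.Nodup ∧ (∀ i ∈ L, IsHullVertex P i) ∧
    L.IsChain (IsClockwiseEdge P)

/-! ### A quantum word machine

Words have `w` bits. The machine has classical word registers (numbered by `ℕ`), `K` quantum word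
registers (that is, `K * w` qubits), and an output list. Its programs are finite and do not depend
on the input or on `w`. Input data can be looked up classically or in superposition.
-/

/-- Elementary operations on words. Comparisons return `1` or `0`. The last two look up the
coordinates of the input point whose index is the first argument. -/
inductive WordOp where
  | lit (n : ℕ)
  | fst
  | add
  | sub
  | mul
  | and
  | or
  | xor
  | shl
  | shr
  | eq
  | ult
  | slt
  | xCoord
  | yCoord

/-- The input table: the pair of words stored at each address. -/
abbrev Table (w : ℕ) := BitVec w → BitVec w × BitVec w

/-- The table holding the points `P 0, …, P (m - 1)`, with coordinates in two's complement. -/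
def tableOf (w : ℕ) {m : ℕ} (P : Fin m → ℤ × ℤ) : Table w := fun a =>
  if h : a.toNat < m then
    (BitVec.ofInt w (P ⟨a.toNat, h⟩).1, BitVec.ofInt w (P ⟨a.toNat, h⟩).2)
  else (0, 0)

/-- The value of an elementary operation. Arithmetic is modulo `2 ^ w`. -/
def WordOp.eval {w : ℕ} (D : Table w) : WordOp → BitVec w → BitVec w → BitVec w
  | .lit n, _, _ => BitVec.ofNat w n
  | .fst, a, _ => a
  | .add, a, b => a + b
  | .sub, a, b => a - b
  | .mul, a, b => a * b
  | .and, a, b => a &&& b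
  | .or, a, b => a ||| b
  | .xor, a, b => a ^^^ b
  | .shl, a, b => a <<< b
  | .shr, a, b => a >>> b
  | .eq, a, b => if a = b then 1 else 0
  | .ult, a, b => if a.toNat < b.toNat then 1 else 0
  | .slt, a, b => if a.toInt < b.toInt then 1 else 0
  | .xCoord, a, _ => (D a).1
  | .yCoord, a, _ => (D a).2

/-- One-qubit gates: Hadamard, Pauli Z and the `π / 4` phase gate. -/
inductive Gate where
  | H
  | Z
  | T

/-- The matrix entries `⟨a| U |b⟩` of the one-qubit gates. -/
noncomputable def Gate.entry : Gate → Bool → Bool → ℂ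
  | .H, a, b => if a && b then -((Real.sqrt 2 : ℝ) : ℂ)⁻¹ else ((Real.sqrt 2 : ℝ) : ℂ)⁻¹
  | .Z, a, b => if a = b then (if a then -1 else 1) else 0
  | .T, a, b => if a = b then (if a then Complex.exp (Complex.I * (Real.pi / 4 : ℝ)) else 1) else 0

/-- An argument of a reversible operation on the quantum registers: a quantum register or a
classical register. -/
inductive Arg (K : ℕ) where
  | q (r : Fin K)
  | c (x : ℕ)

/-- Programs over `K` quantum word registers.
* `assign x o y z`: the classical register `x` receives `o` applied to registers `y` and `z`;
* `emit x`: append the content of the classical register `x` to the output;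
* `apply r o a b`: the unitary that XORs the value of `o` at `a`, `b` into quantum register `r`;
* `gate g r x`: apply the one-qubit gate `g` to one bit of quantum register `r`, the position of
  the bit being the content of the classical register `x`;
* `measure x r`: measure quantum register `r` in the computational basis and store the outcome in
  the classical register `x`;
* `seq`, `ite x` and `loop x`: composition, branching, and iteration while `x` is nonzero. -/
inductive Prog (K : ℕ) where
  | assign (x : ℕ) (o : WordOp) (y z : ℕ)
  | emit (x : ℕ)
  | apply (r : Fin K) (o : WordOp) (a b : Arg K)
  | gate (g : Gate) (r : Fin K) (x : ℕ)
  | measure (x : ℕ) (r : Fin K)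
  | seq (p q : Prog K)
  | ite (x : ℕ) (p q : Prog K)
  | loop (x : ℕ) (p : Prog K)

/-- Computational basis states of the quantum registers. -/
abbrev Basis (K w : ℕ) := Fin K → BitVec w

/-- Memory of the machine: classical registers, output, and amplitudes of the quantum registers.
After measurements the amplitudes are not renormalized, so that the sum of their squared moduli is
the probability of the measurement outcomes observed so far (Born rule). -/
structure Mem (K w : ℕ) where
  reg : ℕ → BitVec w
  out : List (BitVec w)
  amp : Basis K w → ℂ

def Arg.val {K w : ℕ} (reg : ℕ → BitVec w) (b : Basis K w) : Arg K → BitVec w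
  | .q r => b r
  | .c x => reg x

/-- The permutation of basis states performed by `apply r o a b`. The arguments are read with
register `r` cleared, so that this is an involution even if `r` occurs among them. -/
def applyBasis {K w : ℕ} (D : Table w) (reg : ℕ → BitVec w) (r : Fin K) (o : WordOp)
    (a b : Arg K) (v : Basis K w) : Basis K w :=
  Function.update v r
    (v r ^^^ o.eval D (a.val reg (Function.update v r 0)) (b.val reg (Function.update v r 0)))

/-- The word `v` with bit `j` set to `b` (for `j < w`). -/
def setBit {w : ℕ} (v : BitVec w) (j : ℕ) (b : Bool) : BitVec w :=
  if v.getLsbD j = b then v else v ^^^ BitVec.twoPow w j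

/-- A one-qubit gate applied to bit `j` of register `r` (nothing happens if there is no such
bit). -/
noncomputable def gateAmp {K w : ℕ} (g : Gate) (r : Fin K) (j : ℕ) (ψ : Basis K w → ℂ) :
    Basis K w → ℂ := fun v =>
  if j < w then
    ∑ b : Bool, g.entry ((v r).getLsbD j) b * ψ (Function.update v r (setBit (v r) j b))
  else ψ v

/-- `haltProb D target t S μ` is the probability that the machine, started in memory `μ` with the
list `S` of programs still to be executed one after the other, halts after at most `t` steps with
output exactly `target`. Every elementary operation, gate, data access (classical or quantum),
measurement, output, test or sequencing is one step. -/
noncomputable def haltProb {K w : ℕ} (D : Table w) (target : List (BitVec w)) :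
    ℕ → List (Prog K) → Mem K w → ℝ
  | _, [], μ => if μ.out = target then ∑ v, ‖μ.amp v‖ ^ 2 else 0
  | 0, _ :: _, _ => 0
  | t + 1, .assign x o y z :: S, μ =>
      haltProb D target t S
        { μ with reg := Function.update μ.reg x (o.eval D (μ.reg y) (μ.reg z)) }
  | t + 1, .emit x :: S, μ => haltProb D target t S { μ with out := μ.out ++ [μ.reg x] }
  | t + 1, .apply r o a b :: S, μ =>
      haltProb D target t S { μ with amp := fun v => μ.amp (applyBasis D μ.reg r o a b v) }
  | t + 1, .gate g r x :: S, μ =>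
      haltProb D target t S { μ with amp := gateAmp g r (μ.reg x).toNat μ.amp }
  | t + 1, .measure x r :: S, μ =>
      ∑ a : BitVec w, haltProb D target t S
        { μ with
          reg := Function.update μ.reg x a
          amp := fun v => if v r = a then μ.amp v else 0 }
  | t + 1, .seq p q :: S, μ => haltProb D target t (p :: q :: S) μ
  | t + 1, .ite x p q :: S, μ =>
      haltProb D target t ((if μ.reg x ≠ 0 then p else q) :: S) μ
  | t + 1, .loop x p :: S, μ =>
      haltProb D target t (if μ.reg x ≠ 0 then p :: .loop x p :: S else S) μ

/-- Initial memory: the classical registers `0`, `1`, `2` hold `m`, `s`, `f`, all other registers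
are zero, the quantum registers are in the state `|0 … 0⟩`, and the output is empty. -/
noncomputable def initMem (K w : ℕ) (m s f : ℕ) : Mem K w where
  reg := fun x => if x = 0 then BitVec.ofNat w m else if x = 1 then BitVec.ofNat w s
    else if x = 2 then BitVec.ofNat w f else 0
  out := []
  amp := fun v => if v = 0 then 1 else 0

/-- The probability that program `p`, run on the points `P` and the indices `s`, `f`, halts after
at most `t` steps and has then output exactly the list `L` of indices. -/
noncomputable def outputProb {K : ℕ} (p : Prog K) (w : ℕ) {m : ℕ} (P : Fin m → ℤ × ℤ)
    (s f : Fin m) (L : List (Fin m)) (t : ℕ) : ℝ :=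
  haltProb (tableOf w P) (L.map fun i => BitVec.ofNat w i) t [p] (initMem K w m s f)

/-! ### Basic properties of `haltProb` -/

section Logic

variable {K w : ℕ} {D : Table w} {target : List (BitVec w)}

/-! The algorithm is gift wrapping in which every wrap is a quantum maximum search. Seen from a hull
vertex `p`, all other points lie in an open half-plane, so `Beats` is a strict total order on the
points, with `p` at the bottom (`beats_trans`, `beats_total`). Its maximum is exactly the clockwise
neighbour of `p`, with collinear points resolved in favour of the farthest one
(`not_beats_of_isClockwiseEdge`, `isClockwiseEdge_of_forall_not_beats`). The walk reaches the final
vertex without repetition because it descends strictly in the order seen from the starting vertex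
(`isClockwiseEdge_step`, `exists_walk`).

To find the maximum, call the rank of a candidate the number of points that beat it. Grover search
among the points beating the current candidate returns a uniformly random one (`groverStep_iterate`,
`sum_groverStep_iterate`). The rank is unknown, so a sweep tries `2 ^ i - 1` iterations for `i = 0,
…, r`, where `4 ^ r` is the size of the index space; one of these succeeds with probability at least
`1/2` (`exists_half_le_sin_sq`). A uniform better point has at most half the rank on average
(`two_mul_sum_card_beaters_le`), so a sweep multiplies the expected rank by at most `3/4`
(`haltProb_sweep`). Since the rank is a natural number, after `R` sweeps the failure probability is
at most `(3/4) ^ R * m` (`haltProb_search`). With `R` of order `log m` a union bound over the edges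
gives the theorem (`haltProb_walk`); a sweep costs order `√m log m`, and the walk stops by itself at
the last vertex.

Probabilities are handled by backward induction on lower bounds for `haltProb`: a bound for the rest
of the run, as a function of the current candidate, is pulled back through each piece of program.
`Runs` serves for deterministic pieces. Real randomness enters only when the index register is
measured, in `haltProb_attempt`. -/

theorem haltProb_nonneg (t : ℕ) (S : List (Prog K)) (μ : Mem K w) :
    0 ≤ haltProb D target t S μ := by
  induction t generalizing S μ with
  | zero =>
    cases S with
    | nil => rw [haltProb]; split_ifs <;> positivity
    | cons p S => rw [haltProb]
  | succ t ih =>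
    cases S with
    | nil => rw [haltProb]; split_ifs <;> positivity
    | cons p S =>
      cases p <;> rw [haltProb]
      case measure x r => exact Finset.sum_nonneg fun a _ => ih _ _
      all_goals exact ih _ _

theorem haltProb_le_succ (t : ℕ) (S : List (Prog K)) (μ : Mem K w) :
    haltProb D target t S μ ≤ haltProb D target (t + 1) S μ := by
  induction t generalizing S μ with
  | zero =>
    cases S with
    | nil => rw [haltProb, haltProb]
    | cons p S => rw [haltProb]; exact haltProb_nonneg _ _ _
  | succ t ih =>
    cases S with
    | nil => rw [haltProb, haltProb]
    | cons p S =>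
      cases p <;> rw [haltProb, haltProb]
      case measure x r => exact Finset.sum_le_sum fun a _ => ih _ _
      all_goals exact ih _ _

theorem haltProb_mono {t t' : ℕ} (h : t ≤ t') (S : List (Prog K)) (μ : Mem K w) :
    haltProb D target t S μ ≤ haltProb D target t' S μ :=
  monotone_nat_of_le_succ (f := fun t => haltProb D target t S μ)
    (fun t => haltProb_le_succ t S μ) h

/-- Every instruction acts linearly on the amplitudes and acceptance is quadratic in them. Since
states are not renormalized, this turns a collapsed branch into its Born weight times a run from a
normalized basis state. -/
theorem haltProb_smul (z : ℂ) (t : ℕ) (S : List (Prog K)) (μ : Mem K w) :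
    haltProb D target t S { μ with amp := fun v => z * μ.amp v } =
      ‖z‖ ^ 2 * haltProb D target t S μ := by
  induction t generalizing S μ with
  | zero =>
    cases S with
    | nil =>
      rw [haltProb, haltProb]
      simp only [norm_mul, mul_pow, ← Finset.mul_sum]
      split_ifs <;> simp
    | cons p S => rw [haltProb, haltProb, mul_zero]
  | succ t ih =>
    cases S with
    | nil =>
      rw [haltProb, haltProb]
      simp only [norm_mul, mul_pow, ← Finset.mul_sum]
      split_ifs <;> simp
    | cons p S =>
      cases p <;> rw [haltProb, haltProb]
      case measure x r =>
        rw [Finset.mul_sum]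
        refine Finset.sum_congr rfl fun a _ => ?_
        rw [← ih]
        congr 2
        funext v
        by_cases h : v r = a <;> simp [h]
      case gate g r x =>
        rw [← ih]
        congr 2
        funext v
        unfold gateAmp
        dsimp only
        split_ifs
        · rw [Finset.mul_sum]
          exact Finset.sum_congr rfl fun b _ => by ring
        · rfl
      all_goals first | exact ih _ _ | rw [← ih]

/-- Within `T` steps the program `p` takes memory `μ` to memory `μ'`. -/
def Runs (D : Table w) (p : Prog K) (T : ℕ) (μ μ' : Mem K w) : Prop :=
  ∀ target S t, haltProb D target t S μ' ≤ haltProb D target (t + T) (p :: S) μ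

namespace Runs

variable {p q : Prog K} {T T' : ℕ} {μ μ' μ'' : Mem K w}

theorem mono (h : Runs D p T μ μ') (hT : T ≤ T') : Runs D p T' μ μ' := fun target S t =>
  (h target S t).trans (haltProb_mono (by omega) _ _)

theorem assign (x : ℕ) (o : WordOp) (y z : ℕ) (μ : Mem K w) :
    Runs D (.assign x o y z) 1 μ
      { μ with reg := Function.update μ.reg x (o.eval D (μ.reg y) (μ.reg z)) } :=
  fun target S t => by rw [haltProb]

theorem emit (x : ℕ) (μ : Mem K w) :
    Runs D (.emit x) 1 μ { μ with out := μ.out ++ [μ.reg x] } :=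
  fun target S t => by rw [haltProb]

theorem apply (r : Fin K) (o : WordOp) (a b : Arg K) (μ : Mem K w) :
    Runs D (.apply r o a b) 1 μ
      { μ with amp := fun v => μ.amp (applyBasis D μ.reg r o a b v) } :=
  fun target S t => by rw [haltProb]

theorem gate (g : Gate) (r : Fin K) (x : ℕ) (μ : Mem K w) :
    Runs D (.gate g r x) 1 μ { μ with amp := gateAmp g r (μ.reg x).toNat μ.amp } :=
  fun target S t => by rw [haltProb]

/-- All outcomes but one are dropped, which is sound because `Runs` is only a lower bound. Nothing
is lost when the kept outcome is certain, as for the flag in `runs_update`. -/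
theorem measure (x : ℕ) (r : Fin K) (a : BitVec w) (μ : Mem K w) :
    Runs D (.measure x r) 1 μ
      { μ with
        reg := Function.update μ.reg x a
        amp := fun v => if v r = a then μ.amp v else 0 } :=
  fun target S t => by
    rw [haltProb]
    exact Finset.single_le_sum (f := fun a => haltProb D target t S
      { μ with
        reg := Function.update μ.reg x a
        amp := fun v => if v r = a then μ.amp v else 0 })
      (fun _ _ => haltProb_nonneg _ _ _) (Finset.mem_univ a)

theorem seq (hp : Runs D p T μ μ') (hq : Runs D q T' μ' μ'') :
    Runs D (.seq p q) (T + T' + 1) μ μ'' := fun target S t => by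
  rw [show t + (T + T' + 1) = (t + T' + T) + 1 by ring, haltProb]
  exact (hq target S t).trans (hp target _ _)

theorem ite_true {x : ℕ} (hx : μ.reg x ≠ 0) (hp : Runs D p T μ μ') :
    Runs D (.ite x p q) (T + 1) μ μ' := fun target S t => by
  rw [← add_assoc, haltProb, if_pos hx]
  exact hp target S t

theorem ite_false {x : ℕ} (hx : μ.reg x = 0) (hq : Runs D q T μ μ') :
    Runs D (.ite x p q) (T + 1) μ μ' := fun target S t => by
  rw [← add_assoc, haltProb, if_neg (not_not.2 hx)]
  exact hq target S t

theorem loop_done {x : ℕ} (hx : μ.reg x = 0) : Runs D (.loop x p) 1 μ μ := fun target S t => by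
  rw [haltProb, if_neg (not_not.2 hx)]

theorem loop_step {x : ℕ} (hx : μ.reg x ≠ 0) (hp : Runs D p T μ μ')
    (hl : Runs D (.loop x p) T' μ' μ'') : Runs D (.loop x p) (T + T' + 1) μ μ'' :=
  fun target S t => by
    rw [show t + (T + T' + 1) = (t + T' + T) + 1 by ring, haltProb, if_pos hx]
    exact (hl target S t).trans (hp target _ _)

/-- A loop that counts down. -/
theorem loop_count {x : ℕ} {ν : ℕ → Mem K w} {n : ℕ} (h0 : (ν 0).reg x = 0)
    (hs : ∀ k < n, (ν (k + 1)).reg x ≠ 0 ∧ Runs D p T (ν (k + 1)) (ν k)) :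
    Runs D (.loop x p) (n * (T + 1) + 1) (ν n) (ν 0) := by
  induction n with
  | zero => simpa using loop_done (p := p) h0
  | succ n ih =>
    obtain ⟨h1, h2⟩ := hs n (Nat.lt_succ_self n)
    refine (loop_step h1 h2 (ih fun k hk => hs k (by omega))).mono (le_of_eq ?_)
    ring

end Runs

/-- Sequential composition of a list of programs. -/
def block : List (Prog K) → Prog K
  | [] => .assign 3 .fst 3 3
  | p :: ps => .seq p (block ps)

/-- The empty block copies register `3` onto itself, so it is a no-op that still costs one step. -/
theorem Runs.block_nil (μ : Mem K w) : Runs D (block []) 1 μ μ := by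
  have h := Runs.assign (D := D) 3 .fst 3 3 μ
  simp only [WordOp.eval, Function.update_eq_self] at h
  exact h

theorem Runs.block_cons {p : Prog K} {ps : List (Prog K)} {T T' : ℕ} {μ μ' μ'' : Mem K w}
    (hp : Runs D p T μ μ') (hq : Runs D (block ps) T' μ' μ'') :
    Runs D (block (p :: ps)) (T + T' + 1) μ μ'' :=
  Runs.seq hp hq

end Logic

/-! ### Reversible computations controlled by an index register -/

section Embed

variable {K w : ℕ} {D : Table w}

theorem toNat_zero : (0 : BitVec w).toNat = 0 := by simp

theorem applyBasis_applyBasis (reg : ℕ → BitVec w) (r : Fin K) (o : WordOp) (a b : Arg K)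
    (v : Basis K w) :
    applyBasis D reg r o a b (applyBasis D reg r o a b v) = v := by
  simp [applyBasis]

theorem applyBasis_eq_iff (reg : ℕ → BitVec w) (r : Fin K) (o : WordOp) (a b : Arg K)
    (v u : Basis K w) :
    applyBasis D reg r o a b v = u ↔ v = applyBasis D reg r o a b u := by
  constructor
  · rintro rfl; rw [applyBasis_applyBasis]
  · rintro rfl; rw [applyBasis_applyBasis]

theorem applyBasis_of_ne (reg : ℕ → BitVec w) {r s : Fin K} (h : s ≠ r) (o : WordOp)
    (a b : Arg K) (v : Basis K w) : applyBasis D reg r o a b v s = v s := by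
  simp [applyBasis, h]

/-- A reversible operation: target register, operation, and arguments. -/
abbrev QOp (K : ℕ) := Fin K × WordOp × Arg K × Arg K

/-- The instruction that performs a reversible operation. -/
def QOp.prog (op : QOp K) : Prog K := .apply op.1 op.2.1 op.2.2.1 op.2.2.2

/-- The action of a list of reversible operations on basis states. -/
def runOps (D : Table w) (reg : ℕ → BitVec w) : List (QOp K) → Basis K w → Basis K w
  | [], v => v
  | op :: l, v => runOps D reg l (applyBasis D reg op.1 op.2.1 op.2.2.1 op.2.2.2 v)

theorem runOps_append (reg : ℕ → BitVec w) (l l' : List (QOp K)) (v : Basis K w) :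
    runOps D reg (l ++ l') v = runOps D reg l' (runOps D reg l v) := by
  induction l generalizing v with
  | nil => rfl
  | cons op l ih => exact ih _

/-- Each operation is an involution, so uncomputing is running the list backwards. -/
theorem runOps_reverse (reg : ℕ → BitVec w) (l : List (QOp K)) (v : Basis K w) :
    runOps D reg l.reverse (runOps D reg l v) = v := by
  induction l generalizing v with
  | nil => rfl
  | cons op l ih =>
    rw [List.reverse_cons, runOps_append, show runOps D reg (op :: l) v =
      runOps D reg l (applyBasis D reg op.1 op.2.1 op.2.2.1 op.2.2.2 v) from rfl, ih]
    exact applyBasis_applyBasis _ _ _ _ _ _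

theorem runOps_of_forall_ne (reg : ℕ → BitVec w) {l : List (QOp K)} {s : Fin K}
    (h : ∀ op ∈ l, s ≠ op.1) (v : Basis K w) : runOps D reg l v s = v s := by
  induction l generalizing v with
  | nil => rfl
  | cons op l ih =>
    rw [runOps, ih fun op' h' => h op' (List.mem_cons_of_mem _ h'),
      applyBasis_of_ne _ (h op List.mem_cons_self)]

/-- The argument is not the quantum register `r`. -/
def Arg.Avoids (r : Fin K) : Arg K → Prop
  | .q s => s ≠ r
  | .c _ => True

/-- In a straight-line computation with single assignment, the final contents of the registers
satisfy all the defining equations. -/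
theorem runOps_spec (reg : ℕ → BitVec w) {l : List (QOp K)} {v : Basis K w}
    (h0 : ∀ op ∈ l, v op.1 = 0)
    (h1 : ∀ op ∈ l, op.2.2.1.Avoids op.1 ∧ op.2.2.2.Avoids op.1)
    (h2 : l.Pairwise fun op op' => op.1 ≠ op'.1 ∧ op.2.2.1.Avoids op'.1 ∧ op.2.2.2.Avoids op'.1) :
    ∀ op ∈ l, runOps D reg l v op.1 =
      op.2.1.eval D (op.2.2.1.val reg (runOps D reg l v))
        (op.2.2.2.val reg (runOps D reg l v)) := by
  induction l generalizing v with
  | nil => simp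
  | cons op l ih =>
    rw [List.pairwise_cons] at h2
    obtain ⟨h2, h3⟩ := h2
    have hval : ∀ a : Arg K, a.Avoids op.1 → (∀ op' ∈ l, a.Avoids op'.1) →
        a.val reg (runOps D reg (op :: l) v) = a.val reg (Function.update v op.1 0) := by
      intro a ha hl
      cases a with
      | c x => rfl
      | q s =>
        change runOps D reg l _ s = _
        rw [runOps_of_forall_ne _ (fun op' h' => hl op' h'), applyBasis_of_ne _ ha]
        exact (Function.update_of_ne ha _ _).symm
    intro op' hop'
    rcases List.mem_cons.1 hop' with rfl | hop'
    · rw [hval _ (h1 _ List.mem_cons_self).1 fun op' h' => (h2 op' h').2.1,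
        hval _ (h1 _ List.mem_cons_self).2 fun op' h' => (h2 op' h').2.2, runOps,
        runOps_of_forall_ne _ fun op' h' => (h2 op' h').1]
      simp [applyBasis, h0 _ List.mem_cons_self]
    · refine ih (fun op' h' => ?_) (fun op' h' => h1 op' (List.mem_cons_of_mem _ h')) h3 op' hop'
      rw [applyBasis_of_ne _ (h2 op' h').1.symm, h0 op' (List.mem_cons_of_mem _ h')]

@[simp] theorem setBit_getLsbD (v : BitVec w) (j : ℕ) : setBit v j (v.getLsbD j) = v := by
  simp [setBit]

theorem gateAmp_Z {j : ℕ} (hj : j < w) (r : Fin K) (ψ : Basis K w → ℂ) (v : Basis K w) :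
    gateAmp .Z r j ψ v = if (v r).getLsbD j then -ψ v else ψ v := by
  have h : ∀ b, (v r).getLsbD j = b → Function.update v r (setBit (v r) j b) = v := by
    rintro _ rfl; simp
  rw [gateAmp, if_pos hj, Fintype.sum_bool]
  cases hb : (v r).getLsbD j <;> simp [Gate.entry, h _ hb]

variable [NeZero K]

/-- The quantum state with amplitude `a x` at the basis state `g x`, for every value `x` of the
index register `0`. -/
def embed (g : BitVec w → Basis K w) (a : BitVec w → ℂ) : Basis K w → ℂ := fun v =>
  if v = g (v 0) then a (v 0) else 0

/-- The basis state in which the index register holds `x` and the other registers are zero. -/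
def base (x : BitVec w) : Basis K w := Function.update 0 0 x

@[simp] theorem base_zero_apply (x : BitVec w) : (base x : Basis K w) 0 = x := by simp [base]

/-- Amplitudes transform by precomposition; as the permutation is its own inverse, this equals
moving the basis states forward. The index register is untouched and still labels the branches. -/
theorem embed_comp_applyBasis (g : BitVec w → Basis K w) (a : BitVec w → ℂ)
    (reg : ℕ → BitVec w) {r : Fin K} (hr : r ≠ 0) (o : WordOp) (y z : Arg K) :
    (fun v => embed g a (applyBasis D reg r o y z v)) =
      embed (fun x => applyBasis D reg r o y z (g x)) a := by
  funext v
  simp only [embed, applyBasis_of_ne reg hr.symm, applyBasis_eq_iff]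

theorem Runs.ops {l : List (QOp K)} (hl : ∀ op ∈ l, op.1 ≠ 0) (reg : ℕ → BitVec w)
    (out : List (BitVec w)) (g : BitVec w → Basis K w) (a : BitVec w → ℂ) :
    Runs D (block (l.map QOp.prog)) (2 * l.length + 1) ⟨reg, out, embed g a⟩
      ⟨reg, out, embed (fun x => runOps D reg l (g x)) a⟩ := by
  induction l generalizing g with
  | nil => exact Runs.block_nil _
  | cons op l ih =>
    have h := Runs.apply (D := D) op.1 op.2.1 op.2.2.1 op.2.2.2 ⟨reg, out, embed g a⟩
    rw [embed_comp_applyBasis _ _ _ (hl op List.mem_cons_self)] at h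
    refine (Runs.block_cons h (ih (fun op' h' => hl op' (List.mem_cons_of_mem _ h')) _)).mono ?_
    simp only [List.length_cons]; omega

theorem Runs.ops_reverse {l : List (QOp K)} (hl : ∀ op ∈ l, op.1 ≠ 0) (reg : ℕ → BitVec w)
    (out : List (BitVec w)) (g : BitVec w → Basis K w) (a : BitVec w → ℂ) :
    Runs D (block (l.reverse.map QOp.prog)) (2 * l.length + 1)
      ⟨reg, out, embed (fun x => runOps D reg l (g x)) a⟩ ⟨reg, out, embed g a⟩ := by
  have h := Runs.ops (D := D) (l := l.reverse) (fun op h => hl op (List.mem_reverse.1 h)) reg out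
    (fun x => runOps D reg l (g x)) a
  simpa only [runOps_reverse, List.length_reverse] using h

/-- Compute, flip the phase if bit `0` of register `r` is set, and uncompute. -/
def phase (l : List (QOp K)) (r : Fin K) : Prog K :=
  block [block (l.map QOp.prog), .gate .Z r 3, block (l.reverse.map QOp.prog)]

theorem Runs.phase {l : List (QOp K)} (hl : ∀ op ∈ l, op.1 ≠ 0) (r : Fin K) (hw : 0 < w)
    {reg : ℕ → BitVec w} (h3 : reg 3 = 0) (out : List (BitVec w)) (a : BitVec w → ℂ) :
    Runs D (phase l r) (4 * l.length + 7) ⟨reg, out, embed base a⟩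
      ⟨reg, out, embed base fun x =>
        if (runOps D reg l (base x) r).getLsbD 0 then -a x else a x⟩ := by
  have h1 := Runs.ops (D := D) hl reg out base a
  have h2 := Runs.gate (D := D) .Z r 3 ⟨reg, out, embed (fun x => runOps D reg l (base x)) a⟩
  have h3' := Runs.ops_reverse (D := D) hl reg out base fun x =>
        if (runOps D reg l (base x) r).getLsbD 0 then -a x else a x
  have e : gateAmp .Z r (reg 3).toNat (embed (fun x => runOps D reg l (base x)) a) =
      embed (fun x => runOps D reg l (base x)) fun x =>
        if (runOps D reg l (base x) r).getLsbD 0 then -a x else a x := by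
    funext v
    rw [h3, toNat_zero, gateAmp_Z hw]
    by_cases hv : v = runOps D reg l (base (v 0))
    · simp only [embed, ← hv, if_true]
    · simp [embed, if_neg hv]
  dsimp only at h2
  rw [e] at h2
  refine (Runs.block_cons h1 (Runs.block_cons h2 (Runs.block_cons h3' (Runs.block_nil _)))).mono ?_
  omega

end Embed

/-! ### The Hadamard transform on the low bits of the index register -/

section Hadamard

variable {K w : ℕ} {D : Table w}

theorem getLsbD_setBit_self {j : ℕ} (hj : j < w) (v : BitVec w) (b : Bool) :
    (setBit v j b).getLsbD j = b := by
  unfold setBit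
  split_ifs with h
  · exact h
  · simp only [BitVec.getLsbD_xor, BitVec.getLsbD_twoPow, hj, decide_true, Bool.true_and]
    revert h
    cases v.getLsbD j <;> cases b <;> simp

theorem getLsbD_setBit_of_ne {i j : ℕ} (h : i ≠ j) (v : BitVec w) (b : Bool) :
    (setBit v j b).getLsbD i = v.getLsbD i := by
  unfold setBit
  split_ifs
  · rfl
  · simp [BitVec.getLsbD_twoPow, Ne.symm h]

theorem setBit_setBit {j : ℕ} (hj : j < w) (v : BitVec w) (b b' : Bool) :
    setBit (setBit v j b) j b' = setBit v j b' := by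
  refine BitVec.eq_of_getLsbD_eq fun i _ => ?_
  by_cases h : i = j
  · subst h; rw [getLsbD_setBit_self hj, getLsbD_setBit_self hj]
  · simp only [getLsbD_setBit_of_ne h]

theorem setBit_comm {i j : ℕ} (hi : i < w) (hj : j < w) (h : i ≠ j) (v : BitVec w) (b b' : Bool) :
    setBit (setBit v i b) j b' = setBit (setBit v j b') i b := by
  refine BitVec.eq_of_getLsbD_eq fun k _ => ?_
  by_cases h1 : k = i
  · subst h1; rw [getLsbD_setBit_self hi, getLsbD_setBit_of_ne h, getLsbD_setBit_self hi]
  · by_cases h2 : k = j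
    · subst h2; rw [getLsbD_setBit_self hj, getLsbD_setBit_of_ne h1, getLsbD_setBit_self hj]
    · simp only [getLsbD_setBit_of_ne h1, getLsbD_setBit_of_ne h2]

/-- The Hadamard gate on bit `j`. -/
noncomputable def hadamardAt (j : ℕ) (a : BitVec w → ℂ) : BitVec w → ℂ := fun x =>
  ∑ b : Bool, Gate.entry .H (x.getLsbD j) b * a (setBit x j b)

/-- The Hadamard gates on the bits `n - 1, …, 0`. -/
noncomputable def hadamardLow : ℕ → (BitVec w → ℂ) → (BitVec w → ℂ)
  | 0, a => a
  | n + 1, a => hadamardLow n (hadamardAt n a)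

theorem inv_sqrt_two_mul_self : ((√2 : ℝ) : ℂ)⁻¹ * ((√2 : ℝ) : ℂ)⁻¹ = 1 / 2 := by
  rw [← mul_inv, ← Complex.ofReal_mul, Real.mul_self_sqrt (by norm_num)]
  norm_num

theorem hadamardAt_hadamardAt {j : ℕ} (hj : j < w) (a : BitVec w → ℂ) :
    hadamardAt j (hadamardAt j a) = a := by
  funext x
  have hs := inv_sqrt_two_mul_self
  rw [show a x = a (setBit x j (x.getLsbD j)) by rw [setBit_getLsbD]]
  simp only [hadamardAt, Fintype.sum_bool, getLsbD_setBit_self hj, setBit_setBit hj]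
  cases x.getLsbD j <;> simp only [Gate.entry, Bool.and_true, Bool.and_false, if_true,
    Bool.false_eq_true, if_false]
  · linear_combination (2 * a (setBit x j false)) * hs
  · linear_combination (2 * a (setBit x j true)) * hs

theorem hadamardAt_comm {i j : ℕ} (hi : i < w) (hj : j < w) (h : i ≠ j) (a : BitVec w → ℂ) :
    hadamardAt i (hadamardAt j a) = hadamardAt j (hadamardAt i a) := by
  funext x
  simp only [hadamardAt, Fintype.sum_bool, getLsbD_setBit_of_ne h, getLsbD_setBit_of_ne h.symm,
    setBit_comm hi hj h]
  ring

/-- Gates on different bits commute. This lets the top gate be peeled off from either end, which the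
inductions for the involution and for the uniform superposition need. -/
theorem hadamardLow_hadamardAt {n j : ℕ} (hn : n ≤ j) (hj : j < w) (a : BitVec w → ℂ) :
    hadamardLow n (hadamardAt j a) = hadamardAt j (hadamardLow n a) := by
  induction n generalizing a with
  | zero => rfl
  | succ n ih =>
    rw [hadamardLow, hadamardLow, hadamardAt_comm (by omega) hj (by omega), ih (by omega)]

theorem hadamardLow_hadamardLow {n : ℕ} (hn : n ≤ w) (a : BitVec w → ℂ) :
    hadamardLow n (hadamardLow n a) = a := by
  induction n generalizing a with
  | zero => rfl
  | succ n ih =>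
    rw [hadamardLow, hadamardLow, ← hadamardLow_hadamardAt le_rfl (by omega),
      hadamardAt_hadamardAt (by omega), ih (by omega)]

theorem hadamardLow_sub (n : ℕ) (a b : BitVec w → ℂ) :
    hadamardLow n (a - b) = hadamardLow n a - hadamardLow n b := by
  induction n generalizing a b with
  | zero => rfl
  | succ n ih =>
    rw [hadamardLow, hadamardLow, hadamardLow, ← ih]
    congr 1
    funext x
    simp only [hadamardAt, Pi.sub_apply, Fintype.sum_bool]
    ring

theorem hadamardLow_smul (n : ℕ) (z : ℂ) (a : BitVec w → ℂ) :
    hadamardLow n (z • a) = z • hadamardLow n a := by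
  induction n generalizing a with
  | zero => rfl
  | succ n ih =>
    rw [hadamardLow, hadamardLow, ← ih]
    congr 1
    funext x
    simp only [hadamardAt, Pi.smul_apply, smul_eq_mul, Fintype.sum_bool]
    ring

/-- The words that are less than `2 ^ n`. -/
def low (w n : ℕ) : Finset (BitVec w) := {x | x.toNat < 2 ^ n}

@[simp] theorem mem_low {n : ℕ} {x : BitVec w} : x ∈ low w n ↔ x.toNat < 2 ^ n := by simp [low]

theorem mem_low_iff_getLsbD {n : ℕ} {x : BitVec w} :
    x ∈ low w n ↔ ∀ i, n ≤ i → x.getLsbD i = false := by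
  rw [mem_low]
  constructor
  · intro h i hi
    exact Nat.testBit_lt_two_pow (h.trans_le (Nat.pow_le_pow_right (by norm_num) hi))
  · intro h
    exact Nat.lt_pow_two_of_testBit _ h

theorem low_zero : low w 0 = {0} := by
  ext x
  rw [mem_low, Finset.mem_singleton, pow_zero, Nat.lt_one_iff, ← BitVec.toNat_inj,
    toNat_zero]

theorem mem_low_succ_iff {n : ℕ} (hn : n < w) {x : BitVec w} :
    x ∈ low w (n + 1) ↔ setBit x n false ∈ low w n := by
  simp only [mem_low_iff_getLsbD]
  constructor
  · intro h i hi
    rcases eq_or_lt_of_le hi with rfl | hi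
    · rw [getLsbD_setBit_self hn]
    · rw [getLsbD_setBit_of_ne hi.ne', h i hi]
  · intro h i hi
    rw [← getLsbD_setBit_of_ne (by omega : i ≠ n) x false, h i (by omega)]

/-- The words are paired by toggling bit `n`; this drives the inductions on the number of bits. -/
theorem sum_low_succ {M : Type*} [AddCommMonoid M] {n : ℕ} (hn : n < w) (f : BitVec w → M) :
    ∑ x ∈ low w (n + 1), f x = ∑ x ∈ low w n, (f x + f (setBit x n true)) := by
  rw [Finset.sum_add_distrib, ← Finset.sum_filter_add_sum_filter_not _ (fun x => x ∈ low w n)]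
  congr 1
  · refine Finset.sum_congr ?_ fun _ _ => rfl
    ext x
    simp only [Finset.mem_filter, mem_low, pow_succ]
    omega
  · refine Finset.sum_nbij' (fun x => setBit x n false) (fun x => setBit x n true) ?_ ?_ ?_ ?_ ?_
    · intro x hx
      exact (mem_low_succ_iff hn).1 (Finset.mem_filter.1 hx).1
    · intro x hx
      refine Finset.mem_filter.2 ⟨?_, fun h => ?_⟩
      · rw [mem_low_succ_iff hn, setBit_setBit hn]
        have := mem_low_iff_getLsbD.1 hx n le_rfl
        rwa [← this, setBit_getLsbD]
      · have := mem_low_iff_getLsbD.1 h n le_rfl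
        rw [getLsbD_setBit_self hn] at this
        cases this
    · intro x hx
      obtain ⟨h1, h2⟩ := Finset.mem_filter.1 hx
      have : x.getLsbD n = true := by
        by_contra h
        rw [mem_low_succ_iff hn, ← Bool.eq_false_of_not_eq_true h, setBit_getLsbD] at h1
        exact h2 h1
      simp only [setBit_setBit hn]
      rw [← this, setBit_getLsbD]
    · intro x hx
      simp only [setBit_setBit hn]
      have := mem_low_iff_getLsbD.1 hx n le_rfl
      rw [← this, setBit_getLsbD]
    · intro x hx
      obtain ⟨h1, h2⟩ := Finset.mem_filter.1 hx
      have : x.getLsbD n = true := by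
        by_contra h
        rw [mem_low_succ_iff hn, ← Bool.eq_false_of_not_eq_true h, setBit_getLsbD] at h1
        exact h2 h1
      simp only [setBit_setBit hn]
      rw [← this, setBit_getLsbD]

theorem card_low {n : ℕ} (hn : n ≤ w) : (low w n).card = 2 ^ n := by
  induction n with
  | zero => simp [low_zero]
  | succ n ih =>
    have h := sum_low_succ (w := w) (n := n) (by omega) fun _ => 1
    rw [Finset.card_eq_sum_ones, h, Finset.sum_const, ih (by omega)]
    simp [pow_succ]

theorem hadamardLow_apply_zero {n : ℕ} (hn : n ≤ w) (a : BitVec w → ℂ) :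
    hadamardLow n a 0 = (((√2 : ℝ) : ℂ)⁻¹) ^ n * ∑ x ∈ low w n, a x := by
  induction n generalizing a with
  | zero => simp [low_zero, hadamardLow]
  | succ n ih =>
    rw [hadamardLow, ih (by omega), sum_low_succ (by omega), pow_succ, mul_assoc]
    congr 1
    rw [Finset.mul_sum]
    refine Finset.sum_congr rfl fun x hx => ?_
    have h := mem_low_iff_getLsbD.1 hx n le_rfl
    have h' : setBit x n false = x := by rw [← h, setBit_getLsbD]
    simp only [hadamardAt, Fintype.sum_bool, h, h', Gate.entry]
    simp
    ring

theorem hadamardLow_single {n : ℕ} (hn : n ≤ w) :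
    hadamardLow n (Pi.single 0 1 : BitVec w → ℂ) =
      fun x => if x ∈ low w n then (((√2 : ℝ) : ℂ)⁻¹) ^ n else 0 := by
  induction n with
  | zero =>
    funext x
    simp [hadamardLow, low_zero, Pi.single_apply]
  | succ n ih =>
    rw [hadamardLow, hadamardLow_hadamardAt le_rfl (by omega), ih (by omega)]
    funext x
    have h2 : setBit x n true ∉ low w n := fun h => by
      have := mem_low_iff_getLsbD.1 h n le_rfl
      rw [getLsbD_setBit_self (by omega)] at this
      cases this
    simp only [hadamardAt, Fintype.sum_bool, if_neg h2, ← mem_low_succ_iff (by omega : n < w)]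
    simp [Gate.entry, pow_succ, mul_comm]

variable [NeZero K]

/-- With all other registers clear, the gate mixes only basis states of the form `base x`, so the
whole transform can be studied on functions of the index alone. -/
theorem gateAmp_H_embed {j : ℕ} (hj : j < w) (a : BitVec w → ℂ) :
    gateAmp .H (0 : Fin K) j (embed base a) = embed base (hadamardAt j a) := by
  have hb : ∀ (v : Basis K w) (x y : BitVec w), Function.update v 0 x = base x ↔ v = base (v 0) := by
    intro v x _
    simp only [funext_iff, base]
    refine forall_congr' fun i => ?_
    by_cases hi : i = 0
    · subst hi; simp
    · simp [hi]
  funext v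
  rw [gateAmp, if_pos hj]
  by_cases hv : v = base (v 0)
  · simp only [embed, if_pos hv, hadamardAt, Function.update_self, hb v _ 0]
  · simp only [embed, if_neg hv, Function.update_self, hb v _ 0]
    simp

theorem ofNat_succ_sub_one (k : ℕ) : BitVec.ofNat w (k + 1) - 1 = BitVec.ofNat w k := by
  rw [BitVec.ofNat_add]
  exact BitVec.add_sub_cancel _ _

theorem ofNat_ne_zero {k : ℕ} (h0 : k ≠ 0) (h : k < 2 ^ w) : BitVec.ofNat w k ≠ 0 := by
  intro e
  have := congrArg BitVec.toNat e
  rw [BitVec.toNat_ofNat, Nat.mod_eq_of_lt h, toNat_zero] at this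
  exact h0 this

/-- The Hadamard transform on as many bits of the index register as the classical register `17`
says. -/
def hadamardProg : Prog K :=
  block [.assign 14 .fst 17 17, .loop 14 (block [.assign 14 .sub 14 4, .gate .H 0 14])]

/-- The counter is decremented before the gate is applied, so the bits visited are `n - 1, …, 0`. -/
theorem Runs.hadamard_loop {n : ℕ} (hn : n ≤ w) {reg : ℕ → BitVec w} (h4 : reg 4 = 1)
    (out : List (BitVec w)) (a : BitVec w → ℂ) :
    Runs D (.loop 14 (block [.assign 14 .sub 14 4, .gate .H (0 : Fin K) 14])) (6 * n + 1)
      ⟨Function.update reg 14 (BitVec.ofNat w n), out, embed base a⟩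
      ⟨Function.update reg 14 0, out, embed base (hadamardLow n a)⟩ := by
  induction n generalizing a with
  | zero => exact Runs.loop_done (by simp)
  | succ n ih =>
    have hw : n < 2 ^ w := (show n < w by omega).trans Nat.lt_two_pow_self
    have h1 := Runs.assign (D := D) 14 .sub 14 4
      ⟨Function.update reg 14 (BitVec.ofNat w (n + 1)), out, embed (K := K) base a⟩
    have h2 := Runs.gate (D := D) .H 0 14
      ⟨Function.update reg 14 (BitVec.ofNat w n), out, embed (K := K) base a⟩
    have e : n % 2 ^ w = n := Nat.mod_eq_of_lt hw
    simp only [WordOp.eval, Function.update_self, Function.update_idem, ne_eq, h4,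
      show (4 : ℕ) ≠ 14 by norm_num, not_false_eq_true, Function.update_of_ne,
      ofNat_succ_sub_one] at h1
    simp only [Function.update_self, BitVec.toNat_ofNat, e,
      gateAmp_H_embed (show n < w by omega)] at h2
    have h := Runs.loop_step (x := 14) (by
      simpa using ofNat_ne_zero (w := w) (Nat.succ_ne_zero n)
        ((show n + 1 ≤ w from hn).trans_lt Nat.lt_two_pow_self))
      (Runs.block_cons h1 (Runs.block_cons h2 (Runs.block_nil _))) (ih (by omega) (hadamardAt n a))
    exact h.mono (by omega)

theorem Runs.hadamard {n : ℕ} (hn : n ≤ w) {reg : ℕ → BitVec w} (h4 : reg 4 = 1)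
    (h14 : reg 14 = 0) (h17 : reg 17 = BitVec.ofNat w n)
    (out : List (BitVec w)) (a : BitVec w → ℂ) :
    Runs D (hadamardProg (K := K)) (6 * n + 5) ⟨reg, out, embed base a⟩
      ⟨reg, out, embed base (hadamardLow n a)⟩ := by
  have h1 := Runs.assign (D := D) 14 .fst 17 17 ⟨reg, out, embed (K := K) base a⟩
  simp only [WordOp.eval, h17] at h1
  have h2 := Runs.hadamard_loop (D := D) (K := K) hn h4 out a
  rw [← h14, Function.update_eq_self] at h2
  exact (Runs.block_cons h1 (Runs.block_cons h2 (Runs.block_nil _))).mono (by omega)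

end Hadamard

/-! ### Grover iterations -/

section Grover

variable {w : ℕ}

/-- One Grover iteration: flip the phase of the marked words, then invert about the mean. -/
noncomputable def groverStep (n : ℕ) (M : Finset (BitVec w)) (a : BitVec w → ℂ) : BitVec w → ℂ :=
  hadamardLow n fun x =>
    if x = 0 then -hadamardLow n (fun x => if x ∈ M then -a x else a x) x
    else hadamardLow n (fun x => if x ∈ M then -a x else a x) x

/-- Amplitude `α` at the marked words and `β` at the other words below `2 ^ n`. -/
def twoLevel (n : ℕ) (M : Finset (BitVec w)) (α β : ℂ) : BitVec w → ℂ := fun x =>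
  if x ∈ M then α else if x ∈ low w n then β else 0

/-- The marked amplitude matters only if something is marked. This disposes of the division by
`√M.card` when `M` is empty. -/
theorem twoLevel_congr {n : ℕ} {M : Finset (BitVec w)} {α α' β β' : ℂ}
    (h : M.Nonempty → α = α') (h' : β = β') : twoLevel n M α β = twoLevel n M α' β' := by
  funext x
  unfold twoLevel
  split_ifs with hx
  · exact h ⟨x, hx⟩
  · exact h'
  · rfl

theorem sum_low_twoLevel {n : ℕ} (hn : n ≤ w) {M : Finset (BitVec w)} (hM : M ⊆ low w n)
    (α β : ℂ) :
    ∑ x ∈ low w n, twoLevel n M α β x = M.card * α + (2 ^ n - M.card) * β := by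
  rw [← Finset.sum_sdiff hM, add_comm]
  congr 1
  · rw [Finset.sum_congr rfl (g := fun _ => α) fun x hx => by simp [twoLevel, hx]]
    simp
  · rw [Finset.sum_congr rfl (g := fun _ => β) fun x hx => by
      simp only [Finset.mem_sdiff] at hx
      simp only [twoLevel, if_neg hx.2, if_pos hx.1]]
    rw [Finset.sum_const, nsmul_eq_mul, Finset.cast_card_sdiff hM, card_low hn]
    simp

/-- Conjugating the reflection `1 - 2|0⟩⟨0|` by the Hadamard transform gives `1 - 2|u⟩⟨u|`, with `u`
the uniform superposition of the low words. This is minus the usual inversion about the mean. -/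
theorem hadamardLow_flip {n : ℕ} (hn : n ≤ w) (a : BitVec w → ℂ) :
    (hadamardLow n fun x => if x = 0 then -hadamardLow n a x else hadamardLow n a x) =
      fun x => a x - if x ∈ low w n then 2 / 2 ^ n * ∑ y ∈ low w n, a y else 0 := by
  have h : (fun x => if x = 0 then -hadamardLow n a x else hadamardLow n a x) =
      hadamardLow n a - (2 * hadamardLow n a 0) • (Pi.single 0 1 : BitVec w → ℂ) := by
    funext x
    by_cases hx : x = 0
    · subst hx; simp; ring
    · simp only [Pi.sub_apply, Pi.smul_apply, Pi.single_apply, if_neg hx, smul_zero, sub_zero]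
  rw [h, hadamardLow_sub, hadamardLow_hadamardLow hn, hadamardLow_smul, hadamardLow_single hn,
    hadamardLow_apply_zero hn]
  funext x
  simp only [Pi.sub_apply, Pi.smul_apply, smul_eq_mul, mul_ite, mul_zero]
  congr 2
  have e := congrArg (· ^ n) inv_sqrt_two_mul_self
  simp only [mul_pow, div_pow, one_pow] at e
  linear_combination (2 * ∑ y ∈ low w n, a y) * e

theorem groverStep_twoLevel {n : ℕ} (hn : n ≤ w) {M : Finset (BitVec w)} (hM : M ⊆ low w n)
    (α β : ℂ) :
    groverStep n M (twoLevel n M α β) =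
      twoLevel n M (-α - 2 / 2 ^ n * (-(M.card * α) + (2 ^ n - M.card) * β))
        (β - 2 / 2 ^ n * (-(M.card * α) + (2 ^ n - M.card) * β)) := by
  have h : (fun x => if x ∈ M then -twoLevel n M α β x else twoLevel n M α β x) =
      twoLevel n M (-α) β := by
    funext x
    unfold twoLevel
    split_ifs <;> rfl
  rw [groverStep, h, hadamardLow_flip hn, sum_low_twoLevel hn hM, mul_neg]
  funext x
  unfold twoLevel
  by_cases hx : x ∈ M
  · simp [hx, hM hx, -mem_low]
  · by_cases hx' : x ∈ low w n
    · simp [hx, hx', -mem_low]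
    · simp [hx, hx', -mem_low]

/-- The angle of a Grover iteration with `t` marked words among `N`. -/
noncomputable def groverAngle (t N : ℕ) : ℝ := Real.arcsin √((t : ℝ) / N)

theorem groverAngle_le (t N : ℕ) : groverAngle t N ≤ Real.pi / 2 := Real.arcsin_le_pi_div_two _

theorem sin_groverAngle {t N : ℕ} (h : t < N) : Real.sin (groverAngle t N) = √t / √N := by
  have hN : (0 : ℝ) < N := by exact_mod_cast (Nat.zero_le t).trans_lt h
  rw [groverAngle, Real.sin_arcsin, Real.sqrt_div (by positivity)]
  · exact (by norm_num : (-1 : ℝ) ≤ 0).trans (Real.sqrt_nonneg _)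
  · refine Real.sqrt_le_one.2 ((div_le_one hN).2 ?_)
    exact_mod_cast h.le

theorem cos_groverAngle {t N : ℕ} (h : t < N) :
    Real.cos (groverAngle t N) = √((N : ℝ) - t) / √N := by
  have hN : (0 : ℝ) < N := by exact_mod_cast (Nat.zero_le t).trans_lt h
  rw [groverAngle, Real.cos_arcsin, Real.sq_sqrt (by positivity), ← Real.sqrt_div' _ hN.le]
  congr 1
  field_simp

/-- Two reflections compose to a rotation by `2θ` in the plane of the marked and unmarked uniform
states, starting at angle `θ`. The factor `(-1) ^ j` comes from the sign of the second reflection.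
-/
theorem groverStep_iterate {n : ℕ} (hn : n ≤ w) {M : Finset (BitVec w)} (hM : M ⊆ low w n)
    (hlt : M.card < 2 ^ n) (j : ℕ) :
    (groverStep n M)^[j] (hadamardLow n (Pi.single 0 1)) =
      twoLevel n M
        (((-1) ^ j * (Real.sin ((2 * j + 1) * groverAngle M.card (2 ^ n)) / √M.card) : ℝ) : ℂ)
        (((-1) ^ j * (Real.cos ((2 * j + 1) * groverAngle M.card (2 ^ n)) /
          √((2 : ℝ) ^ n - M.card)) : ℝ) : ℂ) := by
  have hs := sin_groverAngle hlt
  have hc := cos_groverAngle hlt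
  set θ := groverAngle M.card (2 ^ n)
  push_cast at hs hc
  have hN : (0 : ℝ) < √((2 : ℝ) ^ n) := by positivity
  have hd : (0 : ℝ) < (2 : ℝ) ^ n - M.card := by
    rw [sub_pos]; exact_mod_cast hlt
  have hd' := Real.sqrt_pos.2 hd
  have hdd := Real.mul_self_sqrt hd.le
  have hNN := Real.mul_self_sqrt (show (0 : ℝ) ≤ 2 ^ n by positivity)
  induction j with
  | zero =>
    rw [Function.iterate_zero, id, hadamardLow_single hn]
    have e : ((√2 : ℝ) : ℂ)⁻¹ ^ n = ((1 / √(2 ^ n) : ℝ) : ℂ) := by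
      push_cast
      rw [inv_pow, one_div, ← Complex.ofReal_pow]
      congr 2
      rw [eq_comm, Real.sqrt_eq_iff_mul_self_eq (by positivity) (by positivity), ← mul_pow,
        Real.mul_self_sqrt (by norm_num)]
    have e' : (fun x => if x ∈ low w n then ((√2 : ℝ) : ℂ)⁻¹ ^ n else 0) =
        twoLevel n M ((1 / √(2 ^ n) : ℝ) : ℂ) ((1 / √(2 ^ n) : ℝ) : ℂ) := by
      funext x
      rw [e, twoLevel]
      by_cases hx : x ∈ M
      · rw [if_pos hx, if_pos (hM hx)]
      · rw [if_neg hx]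
    rw [e']
    refine twoLevel_congr (fun hne => ?_) ?_
    · have ht : (0 : ℝ) < √(M.card : ℝ) := Real.sqrt_pos.2 (by exact_mod_cast hne.card_pos)
      congr 1
      simp only [pow_zero, Nat.cast_zero, mul_zero, zero_add, one_mul, hs]
      field_simp
    · congr 1
      simp only [pow_zero, Nat.cast_zero, mul_zero, zero_add, one_mul, hc]
      field_simp
  | succ j ih =>
    rw [Function.iterate_succ_apply', ih, groverStep_twoLevel hn hM]
    set φ := (2 * (j : ℝ) + 1) * θ with hφ
    have hφ' : (2 * ((j + 1 : ℕ) : ℝ) + 1) * θ = φ + 2 * θ := by rw [hφ]; push_cast; ring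
    have hcos : Real.cos (φ + θ) = Real.cos φ * Real.cos θ - Real.sin φ * Real.sin θ :=
      Real.cos_add _ _
    have h1 : Real.sin (φ + 2 * θ) = Real.sin φ + 2 * Real.sin θ * Real.cos (φ + θ) := by
      rw [Real.sin_add, Real.sin_two_mul, Real.cos_two_mul', hcos]
      have := Real.sin_sq_add_cos_sq θ
      linear_combination Real.sin φ * this
    have h2 : Real.cos (φ + 2 * θ) = -Real.cos φ + 2 * Real.cos θ * Real.cos (φ + θ) := by
      rw [Real.cos_add, Real.sin_two_mul, Real.cos_two_mul', hcos]
      have := Real.sin_sq_add_cos_sq θ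
      linear_combination -Real.cos φ * this
    rw [hφ', h1, h2, hcos, hs, hc]
    have key : (2 : ℝ) / 2 ^ n * (-(M.card * ((-1) ^ j * (Real.sin φ / √M.card))) +
        (2 ^ n - M.card) * ((-1) ^ j * (Real.cos φ / √((2 : ℝ) ^ n - M.card)))) =
        (-1) ^ j * (2 / √(2 ^ n) * (Real.cos φ * (√((2 : ℝ) ^ n - M.card) / √(2 ^ n)) -
          Real.sin φ * (√M.card / √(2 ^ n)))) := by
      have e1 : (M.card : ℝ) / √M.card = √M.card := Real.div_sqrt
      have e2 : ((2 : ℝ) ^ n - M.card) / √((2 : ℝ) ^ n - M.card) = √((2 : ℝ) ^ n - M.card) :=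
        Real.div_sqrt
      have e3 : (2 : ℝ) / 2 ^ n = 2 / √(2 ^ n) * (1 / √(2 ^ n)) := by
        field_simp; rw [sq]; exact hNN
      rw [e3]
      linear_combination (2 / √(2 ^ n) * (1 / √(2 ^ n))) * (-1) ^ j *
        (-Real.sin φ * e1 + Real.cos φ * e2)
    refine twoLevel_congr (fun hne => ?_) ?_
    · have ht : (0 : ℝ) < √(M.card : ℝ) := Real.sqrt_pos.2 (by exact_mod_cast hne.card_pos)
      have := key
      apply_fun (fun z : ℝ => ((-((-1) ^ j * (Real.sin φ / √M.card)) - z : ℝ) : ℂ)) at this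
      push_cast at this ⊢
      rw [this, pow_succ]
      have ht' : ((√(M.card : ℝ) : ℝ) : ℂ) ≠ 0 := by exact_mod_cast ht.ne'
      field_simp
      ring
    · have := key
      apply_fun (fun z : ℝ => ((((-1) ^ j * (Real.cos φ / √((2 : ℝ) ^ n - M.card))) - z : ℝ) : ℂ))
        at this
      push_cast at this ⊢
      rw [this, pow_succ]
      have ht' : ((√((2 : ℝ) ^ n - M.card) : ℝ) : ℂ) ≠ 0 := by exact_mod_cast hd'.ne'
      field_simp
      ring

theorem sum_norm_sq_twoLevel {n : ℕ} {M : Finset (BitVec w)} (hM : M ⊆ low w n) (α β : ℂ)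
    (f : BitVec w → ℝ) :
    ∑ x, ‖twoLevel n M α β x‖ ^ 2 * f x =
      ‖α‖ ^ 2 * ∑ x ∈ M, f x + ‖β‖ ^ 2 * ∑ x ∈ low w n \ M, f x := by
  rw [← Finset.sum_subset (Finset.subset_univ (low w n)) fun x _ hx => by
    rw [twoLevel, if_neg fun h => hx (hM h), if_neg hx]; simp]
  rw [← Finset.sum_sdiff hM, add_comm, Finset.mul_sum, Finset.mul_sum]
  congr 1
  · exact Finset.sum_congr rfl fun x hx => by rw [twoLevel, if_pos hx]
  · refine Finset.sum_congr rfl fun x hx => ?_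
    rw [Finset.mem_sdiff] at hx
    rw [twoLevel, if_neg hx.2, if_pos hx.1]

/-- Measuring after `j` Grover iterations: a marked word is found with probability
`sin ((2 j + 1) θ) ^ 2`, uniformly. -/
theorem sum_groverStep_iterate {n : ℕ} (hn : n ≤ w) {M : Finset (BitVec w)} (hM : M ⊆ low w n)
    (hlt : M.card < 2 ^ n) (j : ℕ) (f : BitVec w → ℝ) (z : ℝ) :
    ∑ x, ‖(groverStep n M)^[j] (hadamardLow n (Pi.single 0 1)) x‖ ^ 2 *
        (if x ∈ M then f x else z) =
      Real.sin ((2 * j + 1) * groverAngle M.card (2 ^ n)) ^ 2 / M.card * ∑ x ∈ M, f x +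
        Real.cos ((2 * j + 1) * groverAngle M.card (2 ^ n)) ^ 2 * z := by
  have hd : (0 : ℝ) < (2 : ℝ) ^ n - M.card := by
    rw [sub_pos]; exact_mod_cast hlt
  rw [groverStep_iterate hn hM hlt, sum_norm_sq_twoLevel hM]
  rw [Finset.sum_congr rfl (s₁ := M) (g := f) fun x hx => if_pos hx,
    Finset.sum_congr rfl (s₁ := low w n \ M) (g := fun _ => z) fun x hx =>
      if_neg (Finset.mem_sdiff.1 hx).2, Finset.sum_const, nsmul_eq_mul, Finset.cast_card_sdiff hM,
      card_low hn]
  simp only [Complex.norm_real, Real.norm_eq_abs, sq_abs, mul_pow, div_pow, ← pow_mul, mul_comm j 2]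
  rw [Real.sq_sqrt hd.le, Real.sq_sqrt (by positivity)]
  simp only [pow_mul, neg_one_sq, one_pow, one_mul]
  congr 1
  push_cast
  field_simp

theorem half_le_sin_sq {y : ℝ} (h1 : Real.pi / 4 ≤ y) (h2 : y ≤ 3 * Real.pi / 4) :
    1 / 2 ≤ Real.sin y ^ 2 := by
  have h := Real.cos_nonpos_of_pi_div_two_le_of_le (x := 2 * y) (by linarith) (by linarith)
  rw [Real.cos_two_mul'] at h
  have := Real.sin_sq_add_cos_sq y
  linarith

/-- One of `r + 1` geometrically growing numbers of iterations is good. -/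
theorem exists_half_le_sin_sq {θ : ℝ} {r : ℕ} (h1 : 1 ≤ 2 ^ r * θ) (h2 : θ ≤ Real.pi / 2) :
    ∃ i ≤ r, 1 / 2 ≤ Real.sin ((2 * ((2 ^ i - 1 : ℕ) : ℝ) + 1) * θ) ^ 2 := by
  have hc : ∀ i : ℕ, 2 * ((2 ^ i - 1 : ℕ) : ℝ) + 1 = 2 * 2 ^ i - 1 := fun i => by
    rw [Nat.cast_sub Nat.one_le_two_pow]; push_cast; ring
  simp only [hc]
  have hθ : 0 < θ := pos_of_mul_pos_right (zero_lt_one.trans_le h1) (by positivity)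
  have hpi := Real.pi_pos
  have hpi4 := Real.pi_le_four
  -- The good scale is the first whose angle reaches `π / 4`. The next angle after `y` is `2 * y + θ
  -- ≤ 3 * y`, so it cannot jump past `3 * π / 4`; at scale `0` the angle is `θ ≤ π / 2`. Scale `r`
  -- suffices because `2 ^ r * θ ≥ 1 ≥ π / 4`.
  have hex : ∃ i, Real.pi / 4 ≤ (2 * 2 ^ i - 1) * θ := by
    refine ⟨r, ?_⟩
    have : (1 : ℝ) ≤ 2 ^ r := one_le_pow₀ (by norm_num)
    nlinarith
  classical
  refine ⟨Nat.find hex, ?_, ?_⟩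
  · refine Nat.find_le ?_
    have : (1 : ℝ) ≤ 2 ^ r := one_le_pow₀ (by norm_num)
    nlinarith
  · refine half_le_sin_sq (Nat.find_spec hex) ?_
    rcases h : Nat.find hex with _ | i
    · norm_num; linarith
    · have h3 := Nat.find_min hex (m := i) (by omega)
      rw [not_le] at h3
      have : (1 : ℝ) ≤ 2 ^ i := one_le_pow₀ (by norm_num)
      rw [pow_succ]
      nlinarith

/-- Here `θ ≥ sin θ = √t / 2 ^ r ≥ 1 / 2 ^ r`. An even number of index bits makes the square root of
the search space an exact power of two. -/
theorem one_le_mul_groverAngle {t r : ℕ} (ht : 0 < t) (h : t < 2 ^ (2 * r)) :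
    1 ≤ 2 ^ r * groverAngle t (2 ^ (2 * r)) := by
  have hs := sin_groverAngle h
  have h0 : 0 ≤ groverAngle t (2 ^ (2 * r)) := Real.arcsin_nonneg.2 (Real.sqrt_nonneg _)
  have h1 := Real.sin_le h0
  have e : √((2 ^ (2 * r) : ℕ) : ℝ) = 2 ^ r := by
    push_cast
    rw [mul_comm, pow_mul, Real.sqrt_sq (by positivity)]
  have h2 : (1 : ℝ) ≤ √(t : ℝ) := Real.one_le_sqrt.2 (by exact_mod_cast ht)
  rw [hs, e, div_le_iff₀ (by positivity)] at h1
  linarith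

end Grover

/-! ### Gift wrapping -/

section Geometry

/-- The cross product `(q - p) × (x - p)` of grid points. -/
def cross (p q x : ℤ × ℤ) : ℤ := (q.1 - p.1) * (x.2 - p.2) - (q.2 - p.2) * (x.1 - p.1)

/-- Seen from `p`, the point `x` lies to the left of `q`, or behind it on the same ray. -/
def Beats (p q x : ℤ × ℤ) : Prop :=
  0 < cross p q x ∨
    cross p q x = 0 ∧ 0 < (x.1 - p.1) * (x.1 - q.1) + (x.2 - p.2) * (x.2 - q.2)

instance (p q x : ℤ × ℤ) : Decidable (Beats p q x) := by unfold Beats; infer_instance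

variable {m : ℕ} {P : Fin m → ℤ × ℤ}

theorem toPlane_injective : Function.Injective toPlane := by
  rintro ⟨a, b⟩ ⟨c, d⟩ h
  simpa [toPlane] using h

/-- An extreme point is outside the convex hull of the other points. That hull is closed, being
generated by finitely many points, so Hahn–Banach separates strictly. -/
theorem exists_sep_of_isHullVertex (hP : Function.Injective P) {i : Fin m}
    (h : IsHullVertex P i) :
    ∃ d : ℝ × ℝ, ∀ k, k ≠ i →
      0 < d.1 * ((P k).1 - (P i).1) + d.2 * ((P k).2 - (P i).2) := by
  obtain ⟨h1, h2⟩ := ((convex_convexHull ℝ _).mem_extremePoints_iff_convex_sdiff).1 h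
  set S := Set.range fun k => toPlane (P k)
  have hni : toPlane (P i) ∉ convexHull ℝ (S \ {toPlane (P i)}) := fun hm =>
    (convexHull_min (Set.sdiff_subset_sdiff_left (subset_convexHull ℝ S)) h2 hm).2 rfl
  have hfin : (S \ {toPlane (P i)}).Finite := (Set.finite_range _).subset Set.sdiff_subset
  obtain ⟨g, u, h3, h4⟩ := geometric_hahn_banach_point_closed (convex_convexHull ℝ _)
    (hfin.isClosed_convexHull ℝ) hni
  have hg : ∀ v : ℝ × ℝ, g v = g (1, 0) * v.1 + g (0, 1) * v.2 := fun v => by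
    conv_lhs => rw [show v = v.1 • ((1 : ℝ), (0 : ℝ)) + v.2 • ((0 : ℝ), (1 : ℝ)) by ext <;> simp]
    rw [map_add, map_smul, map_smul, smul_eq_mul, smul_eq_mul]
    ring
  refine ⟨(g (1, 0), g (0, 1)), fun k hk => ?_⟩
  have h5 := h3.trans (h4 (toPlane (P k)) (subset_convexHull ℝ _
    ⟨⟨k, rfl⟩, fun e => hk (hP (toPlane_injective e))⟩))
  rw [hg, hg (toPlane (P k))] at h5
  simp only [toPlane] at h5
  linarith

/-- A unique maximizer of a linear functional is extreme: the open half-plane below it together with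
the point itself is convex, hence contains the hull. -/
theorem isHullVertex_of_sep {i : Fin m} (d : ℝ × ℝ)
    (h : ∀ k, k ≠ i → d.1 * ((P k).1 - (P i).1) + d.2 * ((P k).2 - (P i).2) < 0) :
    IsHullVertex P i := by
  let l : ℝ × ℝ → ℝ := fun v => d.1 * (v.1 - (P i).1) + d.2 * (v.2 - (P i).2)
  have hsub : hull P ⊆ {v | l v < 0 ∨ v = toPlane (P i)} := by
    refine convexHull_min ?_ ?_
    · rintro _ ⟨k, rfl⟩
      by_cases hk : k = i
      · exact Or.inr (by rw [hk])
      · exact Or.inl (h k hk)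
    · intro x hx y hy a b ha hb hab
      have hl : l (a • x + b • y) = a * l x + b * l y := by
        simp only [l, Prod.fst_add, Prod.snd_add, Prod.smul_fst, Prod.smul_snd, smul_eq_mul]
        linear_combination (d.1 * (P i).1 + d.2 * (P i).2) * hab
      have h0 : l (toPlane (P i)) = 0 := by simp [l, toPlane]
      rcases ha.eq_or_lt with rfl | ha
      · rw [zero_add] at hab; subst hab; simpa using hy
      rcases hb.eq_or_lt with rfl | hb
      · rw [add_zero] at hab; subst hab; simpa using hx
      rcases hx with hx | rfl
      · left
        rw [hl]
        have : l y ≤ 0 := by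
          rcases hy with hy | rfl
          · exact hy.le
          · exact h0.le
        nlinarith
      · rcases hy with hy | rfl
        · left
          rw [hl, h0]
          nlinarith
        · right
          rw [← add_smul, hab, one_smul]
  refine ⟨subset_convexHull ℝ _ ⟨i, rfl⟩, ?_⟩
  intro x hx y hy hxy
  obtain ⟨a, b, ha, hb, hab, e⟩ := hxy
  have hl : a * l x + b * l y = 0 := by
    have e1 := congrArg Prod.fst e
    have e2 := congrArg Prod.snd e
    simp only [toPlane, Prod.fst_add, Prod.snd_add, Prod.smul_fst, Prod.smul_snd,
      smul_eq_mul] at e1 e2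
    simp only [l]
    linear_combination (-d.1 * (P i).1 - d.2 * (P i).2) * hab + d.1 * e1 + d.2 * e2
  have h0 : l (toPlane (P i)) = 0 := by simp [l, toPlane]
  rcases hsub hx with hx | hx
  · exfalso
    have : l y ≤ 0 := by
      rcases hsub hy with hy | rfl
      · exact hy.le
      · exact h0.le
    nlinarith
  · exact hx

/-- The turn is affine in its last argument, so the generating points decide. -/
theorem turn_hull_nonpos_iff {i j : Fin m} :
    (∀ p ∈ hull P, turn (toPlane (P i)) (toPlane (P j)) p ≤ 0) ↔
      ∀ k, cross (P i) (P j) (P k) ≤ 0 := by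
  have hc : ∀ k, turn (toPlane (P i)) (toPlane (P j)) (toPlane (P k)) =
      (cross (P i) (P j) (P k) : ℤ) := fun k => by
    simp only [turn, toPlane, cross]; push_cast; ring
  constructor
  · intro h k
    have := h _ (subset_convexHull ℝ _ ⟨k, rfl⟩)
    rw [hc] at this
    exact_mod_cast this
  · intro h
    refine fun p hp => convexHull_min
      (t := {p | turn (toPlane (P i)) (toPlane (P j)) p ≤ 0}) ?_ ?_ hp
    · rintro _ ⟨k, rfl⟩
      change turn _ _ _ ≤ 0
      rw [hc]
      exact_mod_cast h k
    · intro x hx y hy a b ha hb hab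
      have : turn (toPlane (P i)) (toPlane (P j)) (a • x + b • y) =
          a * turn (toPlane (P i)) (toPlane (P j)) x +
            b * turn (toPlane (P i)) (toPlane (P j)) y := by
        simp only [turn, toPlane, Prod.fst_add, Prod.snd_add, Prod.smul_fst, Prod.smul_snd,
          smul_eq_mul]
        linear_combination
          (((P j).1 - (P i).1) * (P i).2 - ((P j).2 - (P i).2) * (P i).1 : ℝ) * hab
      change turn _ _ _ ≤ 0
      rw [this]
      have hx' : turn (toPlane (P i)) (toPlane (P j)) x ≤ 0 := hx
      have hy' : turn (toPlane (P i)) (toPlane (P j)) y ≤ 0 := hy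
      nlinarith

theorem isClockwiseEdge_iff {i j : Fin m} :
    IsClockwiseEdge P i j ↔ i ≠ j ∧ IsHullVertex P i ∧ IsHullVertex P j ∧
      ∀ k, cross (P i) (P j) (P k) ≤ 0 := by
  rw [IsClockwiseEdge, turn_hull_nonpos_iff]

theorem cross_eq_zero_iff_real (p q x : ℤ × ℤ) :
    cross p q x = 0 ↔
      ((q.1 - p.1) * (x.2 - p.2) - (q.2 - p.2) * (x.1 - p.1) : ℝ) = 0 := by
  rw [← Int.cast_inj (α := ℝ), cross]; push_cast; rfl

/-- For a hull vertex `p`, comparison by `Beats` is lexicographic, by direction and distance. -/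
theorem exists_beats_iff (hP : Function.Injective P) {p : Fin m} (hp : IsHullVertex P p) :
    ∃ (d : ℝ × ℝ) (l : Fin m → ℝ),
      (∀ k, l k = d.1 * ((P k).1 - (P p).1) + d.2 * ((P k).2 - (P p).2)) ∧ l p = 0 ∧
      (∀ k, k ≠ p → 0 < l k) ∧
      (∀ a b, l b * ((P a).1 - (P p).1) - l a * ((P b).1 - (P p).1) =
        d.2 * cross (P p) (P a) (P b)) ∧
      (∀ a b, l b * ((P a).2 - (P p).2) - l a * ((P b).2 - (P p).2) =
        -d.1 * cross (P p) (P a) (P b)) ∧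
      ∀ a b, Beats (P p) (P a) (P b) ↔
        0 < cross (P p) (P a) (P b) ∨ cross (P p) (P a) (P b) = 0 ∧ l a < l b := by
  obtain ⟨d, hd⟩ := exists_sep_of_isHullVertex hP hp
  refine ⟨d, fun k => d.1 * ((P k).1 - (P p).1) + d.2 * ((P k).2 - (P p).2), fun k => rfl, by simp,
    hd, fun a b => ?_, fun a b => ?_, fun a b => ?_⟩
  · simp only [cross]; push_cast; ring
  · simp only [cross]; push_cast; ring
  · refine or_congr_right (and_congr_right fun h0 => ?_)
    by_cases hb : b = p
    · subst hb
      have ha : 0 ≤ d.1 * ((P a).1 - (P b).1) + d.2 * ((P a).2 - (P b).2) := by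
        by_cases h : a = b
        · simp [h]
        · exact (hd a h).le
      simp [ha]
    · have hlb := hd b hb
      rw [cross_eq_zero_iff_real] at h0
      have hn : (0 : ℝ) < ((P b).1 - (P p).1) ^ 2 + ((P b).2 - (P p).2) ^ 2 := by
        by_contra hn
        have h1 : ((P b).1 - (P p).1 : ℝ) = 0 := by nlinarith
        have h2 : ((P b).2 - (P p).2 : ℝ) = 0 := by nlinarith
        rw [h1, h2] at hlb
        simp at hlb
      rw [← Int.cast_lt (R := ℝ)]
      push_cast
      rw [← mul_pos_iff_of_pos_left hlb]
      conv_rhs => rw [← sub_pos, ← mul_pos_iff_of_pos_right hn]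
      refine iff_of_eq (congrArg (fun z : ℝ => 0 < z) ?_)
      -- On a common line through `p`, `l b` times the inner product in `Beats` equals `(l b - l a)`
      -- times the squared distance from `p` to `b`.
      linear_combination
        (d.1 * ((P b).2 - (P p).2) - d.2 * ((P b).1 - (P p).1) : ℝ) * h0

theorem beats_irrefl (p a : ℤ × ℤ) : ¬ Beats p a a := by
  simp [Beats, cross, mul_comm]

theorem beats_trans (hP : Function.Injective P) {p : Fin m} (hp : IsHullVertex P p)
    {a b c : Fin m} (hab : Beats (P p) (P a) (P b)) (hbc : Beats (P p) (P b) (P c)) :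
    Beats (P p) (P a) (P c) := by
  obtain ⟨d, l, hl, hlp, hpos, h1, h2, hB⟩ := exists_beats_iff hP hp
  rw [hB] at *
  have hnn : ∀ k, 0 ≤ l k := fun k => by
    by_cases h : k = p
    · rw [h, hlp]
    · exact (hpos k h).le
  have hb : 0 < l b := by
    rcases hab with hab | hab
    · refine hpos b ?_
      rintro rfl
      simp [cross] at hab
    · exact (hnn a).trans_lt hab.2
  -- The three-term Plücker relation: with positive values of `l`, signs of cross products propagate
  -- transitively.
  have key : l b * (cross (P p) (P a) (P c) : ℝ) =
      l a * cross (P p) (P b) (P c) + l c * cross (P p) (P a) (P b) := by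
    simp only [hl, cross]; push_cast; ring
  have hc : 0 < l c := by
    rcases hbc with hbc | hbc
    · refine hpos c ?_
      rintro rfl
      simp [cross] at hbc
    · exact (hnn b).trans_lt hbc.2
  by_cases ha : a = p
  · subst ha
    right
    refine ⟨by simp [cross], by rwa [hlp]⟩
  have ha := hpos a ha
  rcases hab with hab | ⟨hab, hab'⟩ <;> rcases hbc with hbc | ⟨hbc, hbc'⟩
  · left
    have e1 : (0 : ℝ) < cross (P p) (P a) (P b) := by exact_mod_cast hab
    have e2 : (0 : ℝ) < cross (P p) (P b) (P c) := by exact_mod_cast hbc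
    have : 0 < l b * (cross (P p) (P a) (P c) : ℝ) := by rw [key]; positivity
    exact_mod_cast (mul_pos_iff_of_pos_left hb).1 this
  · left
    have e1 : (0 : ℝ) < cross (P p) (P a) (P b) := by exact_mod_cast hab
    have : 0 < l b * (cross (P p) (P a) (P c) : ℝ) := by
      rw [key, hbc, Int.cast_zero, mul_zero, zero_add]; positivity
    exact_mod_cast (mul_pos_iff_of_pos_left hb).1 this
  · left
    have e2 : (0 : ℝ) < cross (P p) (P b) (P c) := by exact_mod_cast hbc
    have : 0 < l b * (cross (P p) (P a) (P c) : ℝ) := by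
      rw [key, hab, Int.cast_zero, mul_zero, add_zero]; positivity
    exact_mod_cast (mul_pos_iff_of_pos_left hb).1 this
  · right
    refine ⟨?_, hab'.trans hbc'⟩
    rw [hab, hbc, Int.cast_zero, mul_zero, mul_zero, add_zero, mul_eq_zero] at key
    exact_mod_cast key.resolve_left hb.ne'

theorem beats_total (hP : Function.Injective P) {p : Fin m} (hp : IsHullVertex P p)
    {a b : Fin m} (hab : a ≠ b) : Beats (P p) (P a) (P b) ∨ Beats (P p) (P b) (P a) := by
  obtain ⟨d, l, hl, hlp, hpos, h1, h2, hB⟩ := exists_beats_iff hP hp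
  have hs : cross (P p) (P b) (P a) = -cross (P p) (P a) (P b) := by simp only [cross]; ring
  rw [hB, hB, hs]
  rcases lt_trichotomy (cross (P p) (P a) (P b)) 0 with h | h | h
  · right; left; omega
  · rcases lt_trichotomy (l a) (l b) with h' | h' | h'
    · exact Or.inl (Or.inr ⟨h, h'⟩)
    · exfalso
      have e1 := h1 a b
      have e2 := h2 a b
      rw [h, Int.cast_zero, mul_zero, h', ← mul_sub] at e1 e2
      by_cases hb : b = p
      · subst hb
        exact (hpos a hab).ne' (h'.trans hlp)
      · have hlb := (hpos b hb).ne'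
        refine hab (hP (Prod.ext ?_ ?_))
        · have := (mul_eq_zero.1 e1).resolve_left hlb
          exact_mod_cast (by linarith : ((P a).1 : ℝ) = (P b).1)
        · have := (mul_eq_zero.1 e2).resolve_left hlb
          exact_mod_cast (by linarith : ((P a).2 : ℝ) = (P b).2)
    · exact Or.inr (Or.inr ⟨by omega, h'⟩)
  · left; left; exact h

/-- A hull vertex is not a proper convex combination of other points. -/
theorem IsHullVertex.false_of_combination (hP : Function.Injective P) {i a b c : Fin m}
    (hi : IsHullVertex P i) (ha : a ≠ i) (hb : b ≠ i) (hc : c ≠ i) {u v z : ℝ} (hu : 0 < u)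
    (hv : 0 ≤ v) (hz : 0 ≤ z)
    (h1 : u * ((P a).1 - (P i).1) + v * ((P b).1 - (P i).1) + z * ((P c).1 - (P i).1) = 0)
    (h2 : u * ((P a).2 - (P i).2) + v * ((P b).2 - (P i).2) + z * ((P c).2 - (P i).2) = 0) :
    False := by
  obtain ⟨d, hd⟩ := exists_sep_of_isHullVertex hP hi
  have ea := mul_pos hu (hd a ha)
  have eb := mul_nonneg hv (hd b hb).le
  have ec := mul_nonneg hz (hd c hc).le
  have : u * (d.1 * ((P a).1 - (P i).1) + d.2 * ((P a).2 - (P i).2)) +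
      v * (d.1 * ((P b).1 - (P i).1) + d.2 * ((P b).2 - (P i).2)) +
      z * (d.1 * ((P c).1 - (P i).1) + d.2 * ((P c).2 - (P i).2)) = 0 := by
    linear_combination d.1 * h1 + d.2 * h2
  linarith

/-- No point lies to the left of an edge, and a point farther out on the same ray would put `j`
strictly between it and `p`, so that `j` would not be a vertex. -/
theorem not_beats_of_isClockwiseEdge (hP : Function.Injective P) {p j : Fin m}
    (h : IsClockwiseEdge P p j) (k : Fin m) : ¬ Beats (P p) (P j) (P k) := by
  obtain ⟨hne, hp, hj, hle⟩ := isClockwiseEdge_iff.1 h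
  obtain ⟨d, l, hl, hlp, hpos, h1, h2, hB⟩ := exists_beats_iff hP hp
  rw [hB]
  rintro (h0 | ⟨h0, hlt⟩)
  · exact absurd h0 (hle k).not_gt
  · have hlj := hpos j hne.symm
    have hkj : k ≠ j := by rintro rfl; exact lt_irrefl _ hlt
    have e1 := h1 j k
    have e2 := h2 j k
    rw [h0, Int.cast_zero, mul_zero] at e1 e2
    exact hj.false_of_combination hP hne hkj hkj (sub_pos.2 hlt) hlj.le le_rfl
      (by linear_combination -e1) (by linear_combination -e2)

theorem isClockwiseEdge_of_forall_not_beats (hP : Function.Injective P) {p q k : Fin m}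
    (hp : IsHullVertex P p) (hk : k ≠ p) (h : ∀ k, ¬ Beats (P p) (P q) (P k)) :
    IsClockwiseEdge P p q := by
  obtain ⟨d, l, hl, hlp, hpos, h1, h2, hB⟩ := exists_beats_iff hP hp
  have hpq : p ≠ q := by
    rintro rfl
    exact h k ((hB _ _).2 (Or.inr ⟨by simp [cross], by rw [hlp]; exact hpos k hk⟩))
  have hle : ∀ k, cross (P p) (P q) (P k) ≤ 0 := fun k => by
    by_contra h0
    exact h k (Or.inl (not_le.1 h0))
  refine isClockwiseEdge_iff.2 ⟨hpq, hp, ?_, hle⟩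
  -- To see that `q` is a vertex, the functional `l` is tilted by `M` times the cross product.
  -- Points on the ray through `q` have smaller `l`; elsewhere the cross product is at most `-1` by
  -- integrality, and `M` exceeds every value of `l`.
  set M := 1 + ∑ k, |l k| with hM
  have hlM : ∀ k, l k < M := fun k => by
    have : |l k| ≤ ∑ k, |l k| :=
      Finset.single_le_sum (f := fun k => |l k|) (fun _ _ => abs_nonneg _) (Finset.mem_univ k)
    have := le_abs_self (l k)
    linarith
  have hM0 : 0 ≤ M := by positivity
  have hq := hpos q hpq.symm
  refine isHullVertex_of_sep (d.1 - M * ((P q).2 - (P p).2), d.2 + M * ((P q).1 - (P p).1))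
    fun k hkq => ?_
  have e : (d.1 - M * ((P q).2 - (P p).2)) * ((P k).1 - (P q).1) +
      (d.2 + M * ((P q).1 - (P p).1)) * ((P k).2 - (P q).2) =
      l k - l q + M * cross (P p) (P q) (P k) := by
    simp only [hl, cross]; push_cast; ring
  change (d.1 - M * ((P q).2 - (P p).2)) * ((P k).1 - (P q).1) +
      (d.2 + M * ((P q).1 - (P p).1)) * ((P k).2 - (P q).2) < 0
  rw [e]
  rcases (hle k).eq_or_lt with h0 | h0
  · have hkq' : Beats (P p) (P k) (P q) := (beats_total hP hp hkq).resolve_right (h k)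
    rw [hB] at hkq'
    have hs : cross (P p) (P k) (P q) = -cross (P p) (P q) (P k) := by simp only [cross]; ring
    rw [h0, Int.cast_zero, mul_zero]
    rcases hkq' with h' | h'
    · omega
    · linarith [h'.2]
  · have : (cross (P p) (P q) (P k) : ℝ) ≤ -1 := by
      exact_mod_cast (by omega : cross (P p) (P q) (P k) ≤ -1)
    have := hlM k
    nlinarith

theorem exists_isClockwiseEdge (hP : Function.Injective P) {p k : Fin m}
    (hp : IsHullVertex P p) (hk : k ≠ p) : ∃ q, IsClockwiseEdge P p q := by
  let r : Fin m → Fin m → Prop := fun a b => Beats (P p) (P b) (P a)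
  have : IsTrans (Fin m) r := ⟨fun a b c h1 h2 => beats_trans hP hp h2 h1⟩
  have : Std.Irrefl r := ⟨fun a => beats_irrefl _ _⟩
  obtain ⟨q, -, hq⟩ := (Finite.wellFounded_of_trans_of_irrefl r).has_min Set.univ ⟨p, trivial⟩
  exact ⟨q, isClockwiseEdge_of_forall_not_beats hP hp hk fun k => hq k trivial⟩

theorem isClockwiseEdge_unique (hP : Function.Injective P) {p q q' : Fin m}
    (h : IsClockwiseEdge P p q) (h' : ∀ k, ¬ Beats (P p) (P q') (P k)) : q = q' := by
  by_contra hne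
  rcases beats_total hP h.2.1 hne with hb | hb
  · exact not_beats_of_isClockwiseEdge hP h _ hb
  · exact h' _ hb

/-- Were the vertices collinear, then, as seen from `a`, the nearer of the other two would lie
between `a` and the farther one. -/
theorem cross_ne_zero (hP : Function.Injective P) {a b c : Fin m} (ha : IsHullVertex P a)
    (hb : IsHullVertex P b) (hc : IsHullVertex P c) (hab : a ≠ b) (hac : a ≠ c) (hbc : b ≠ c) :
    cross (P a) (P b) (P c) ≠ 0 := by
  obtain ⟨d, l, hl, hlp, hpos, h1, h2, hB⟩ := exists_beats_iff hP ha
  intro h0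
  have e1 := h1 b c
  have e2 := h2 b c
  rw [h0, Int.cast_zero, mul_zero] at e1 e2
  have hs : cross (P a) (P c) (P b) = -cross (P a) (P b) (P c) := by simp only [cross]; ring
  rcases beats_total hP ha hbc with h | h
  · have := (((hB _ _).1 h).resolve_left (by omega)).2
    exact hb.false_of_combination hP hab hbc.symm hbc.symm (sub_pos.2 this)
      (hpos b hab.symm).le le_rfl (by linear_combination -e1) (by linear_combination -e2)
  · have := (((hB _ _).1 h).resolve_left (by omega)).2
    exact hc.false_of_combination hP hac hbc hbc (sub_pos.2 this)
      (hpos c hac.symm).le le_rfl (by linear_combination e1) (by linear_combination e2)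

/-- One step of the clockwise walk from `s` does not skip the vertex `f`. -/
theorem isClockwiseEdge_step (hP : Function.Injective P) {s f v n : Fin m}
    (hs : IsHullVertex P s) (hf : IsHullVertex P f) (hsf : s ≠ f) (hvs : v ≠ s) (hvf : v ≠ f)
    (hb : Beats (P s) (P f) (P v)) (h : IsClockwiseEdge P v n) :
    n ≠ s ∧ (n = f ∨ Beats (P s) (P f) (P n)) ∧ Beats (P s) (P n) (P v) := by
  obtain ⟨hvn, hv, hn, hle⟩ := isClockwiseEdge_iff.1 h
  have hsv : 0 < cross (P s) (P f) (P v) := by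
    refine lt_of_le_of_ne ?_ (cross_ne_zero hP hs hf hv hsf hvs.symm hvf.symm).symm
    rcases hb with hb | hb
    · exact hb.le
    · exact hb.1.ge
  have hns : n ≠ s := by
    rintro rfl
    have h1 := hle f
    have : cross (P v) (P n) (P f) = cross (P n) (P f) (P v) := by simp only [cross]; ring
    omega
  refine ⟨hns, ?_, ?_⟩
  · by_contra hcon
    rw [not_or] at hcon
    obtain ⟨hnf, hnb⟩ := hcon
    have hb' := (beats_total hP hs hnf).resolve_right hnb
    have h1 : 0 < cross (P s) (P n) (P f) := by
      refine lt_of_le_of_ne ?_ (cross_ne_zero hP hs hn hf hns.symm hsf hnf).symm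
      rcases hb' with hb' | hb'
      · exact hb'.le
      · exact hb'.1.ge
    have h2 : cross (P v) (P n) (P f) < 0 :=
      lt_of_le_of_ne (hle f) (cross_ne_zero hP hv hn hf hvn hvf hnf)
    -- If the step skipped `f`, then `f` would lie in the triangle of `s`, `v`, `n`; the weights are
    -- its unnormalized barycentric coordinates.
    refine hf.false_of_combination hP hsf hvf hnf (u := -cross (P v) (P n) (P f))
      (v := cross (P s) (P n) (P f)) (z := cross (P s) (P f) (P v)) ?_ ?_ ?_ ?_ ?_
    · exact_mod_cast (by omega : 0 < -cross (P v) (P n) (P f))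
    · exact_mod_cast h1.le
    · exact_mod_cast hsv.le
    · simp only [cross]; push_cast; ring
    · simp only [cross]; push_cast; ring
  · left
    have h1 := hle s
    have h2 := cross_ne_zero hP hv hn hs hvn hvs hns
    have : cross (P s) (P n) (P v) = -cross (P v) (P n) (P s) := by simp only [cross]; ring
    omega

/-- Induction on the number of points that `v` beats as seen from `s`, which drops with every edge.
All later vertices are beaten by `v`, so none repeats, and `f` cannot be skipped by
`isClockwiseEdge_step`. -/
theorem exists_walk (hP : Function.Injective P) {s f : Fin m} (hs : IsHullVertex P s)
    (hf : IsHullVertex P f) (hsf : s ≠ f) (N : ℕ) (v : Fin m) (hv : IsHullVertex P v)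
    (hvs : v ≠ s) (hb : v = f ∨ Beats (P s) (P f) (P v))
    (hN : (Finset.univ.filter fun k => Beats (P s) (P k) (P v)).card ≤ N) :
    ∃ L : List (Fin m), L.head? = some v ∧ L.getLast? = some f ∧ L.Nodup ∧
      (∀ i ∈ L, IsHullVertex P i) ∧ L.IsChain (IsClockwiseEdge P) ∧
      ∀ x ∈ L, x ≠ s ∧ (x = v ∨ Beats (P s) (P x) (P v)) := by
  induction N generalizing v with
  | zero =>
    rcases hb with rfl | hb
    · exact ⟨[v], by simp [hv, hvs]⟩
    · have : f ∈ Finset.univ.filter fun k => Beats (P s) (P k) (P v) := by simpa using hb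
      rw [Finset.card_eq_zero.1 (Nat.le_zero.1 hN)] at this
      simp at this
  | succ N ih =>
    by_cases hvf : v = f
    · subst hvf
      exact ⟨[v], by simp [hv, hvs]⟩
    obtain ⟨n, hn⟩ := exists_isClockwiseEdge hP hv hvs.symm
    obtain ⟨h1, h2, h3⟩ := isClockwiseEdge_step hP hs hf hsf hvs hvf (hb.resolve_left hvf) hn
    obtain ⟨L, hh, hl, hnd, hvert, hch, hx⟩ := ih n hn.2.2.1 h1 h2 (by
      refine Nat.le_of_lt_succ ((Finset.card_lt_card ?_).trans_le hN)
      refine Finset.ssubset_iff_subset_ne.2 ⟨fun k hk => ?_, fun e => ?_⟩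
      · simp only [Finset.mem_filter, Finset.mem_univ, true_and] at hk ⊢
        exact beats_trans hP hs hk h3
      · have : n ∈ Finset.univ.filter fun k => Beats (P s) (P k) (P v) := by simpa using h3
        rw [← e] at this
        exact beats_irrefl _ _ (by simpa using this))
    have hx' : ∀ x ∈ L, x ≠ s ∧ Beats (P s) (P x) (P v) := fun x hxL => by
      obtain ⟨e1, e2⟩ := hx x hxL
      refine ⟨e1, ?_⟩
      rcases e2 with rfl | e2
      · exact h3
      · exact beats_trans hP hs e2 h3
    have hne : L ≠ [] := by rintro rfl; simp at hh
    refine ⟨v :: L, rfl, ?_, ?_, ?_, ?_, ?_⟩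
    · rw [List.getLast?_cons_of_ne_nil hne, hl]
    · exact List.nodup_cons.2 ⟨fun h => beats_irrefl _ _ (hx' v h).2, hnd⟩
    · simpa [hv] using hvert
    · rw [List.isChain_cons]
      refine ⟨fun y hy => ?_, hch⟩
      rw [hh] at hy
      cases hy
      exact hn
    · intro x hxL
      rcases List.mem_cons.1 hxL with rfl | hxL
      · exact ⟨hvs, Or.inl rfl⟩
      · exact ⟨(hx' x hxL).1, Or.inr (hx' x hxL).2⟩

theorem exists_isClockwisePart (hP : Function.Injective P) {s f : Fin m} (hs : IsHullVertex P s)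
    (hf : IsHullVertex P f) : ∃ L, IsClockwisePart P s f L := by
  by_cases hsf : s = f
  · subst hsf
    exact ⟨[s], by simp [IsClockwisePart, hs]⟩
  obtain ⟨n, hn⟩ := exists_isClockwiseEdge hP hs (Ne.symm hsf)
  have hb : n = f ∨ Beats (P s) (P f) (P n) := by
    by_cases h : n = f
    · exact Or.inl h
    · exact Or.inr ((beats_total hP hs h).resolve_left (not_beats_of_isClockwiseEdge hP hn _))
  obtain ⟨L, hh, hl, hnd, hvert, hch, hx⟩ :=
    exists_walk hP hs hf hsf _ n hn.2.2.1 hn.1.symm hb le_rfl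
  have hne : L ≠ [] := by rintro rfl; simp at hh
  refine ⟨s :: L, rfl, ?_, ?_, ?_, ?_⟩
  · rw [List.getLast?_cons_of_ne_nil hne, hl]
  · exact List.nodup_cons.2 ⟨fun h => (hx s h).1 rfl, hnd⟩
  · simpa [hs] using hvert
  · rw [List.isChain_cons]
    refine ⟨fun y hy => ?_, hch⟩
    rw [hh] at hy
    cases hy
    exact hn

theorem isClockwisePart_self_iff {s : Fin m} {L : List (Fin m)}
    (h : IsClockwisePart P s s L) : L = [s] := by
  obtain ⟨hh, hl, hnd, -, -⟩ := h
  cases L with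
  | nil => simp at hh
  | cons a L =>
    cases hh
    cases L with
    | nil => rfl
    | cons b L =>
      rw [List.getLast?_cons_cons] at hl
      exact absurd (List.mem_of_getLast? hl) (List.nodup_cons.1 hnd).1

theorem isClockwisePart_cases {s f : Fin m} (hsf : s ≠ f) {L : List (Fin m)}
    (h : IsClockwisePart P s f L) :
    ∃ n L', L = s :: L' ∧ IsClockwiseEdge P s n ∧ IsClockwisePart P n f L' := by
  obtain ⟨hh, hl, hnd, hv, hch⟩ := h
  cases L with
  | nil => simp at hh
  | cons a L =>
    cases hh
    cases L with
    | nil => simp at hl; exact absurd hl hsf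
    | cons b L =>
      rw [List.isChain_cons_cons] at hch
      rw [List.getLast?_cons_cons] at hl
      exact ⟨b, b :: L, rfl, hch.1, rfl, hl, (List.nodup_cons.1 hnd).2,
        fun i hi => hv i (List.mem_cons_of_mem _ hi), hch.2⟩

theorem isClockwisePart_unique (hP : Function.Injective P) {s f : Fin m} {L L' : List (Fin m)}
    (h : IsClockwisePart P s f L) (h' : IsClockwisePart P s f L') : L = L' := by
  induction L generalizing s L' with
  | nil => simp [IsClockwisePart] at h
  | cons a L ih =>
    by_cases hsf : s = f
    · subst hsf
      rw [isClockwisePart_self_iff h, isClockwisePart_self_iff h']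
    · obtain ⟨n, T, e, hn, hT⟩ := isClockwisePart_cases hsf h
      obtain ⟨n', T', e', hn', hT'⟩ := isClockwisePart_cases hsf h'
      have : n = n' := isClockwiseEdge_unique hP hn (not_beats_of_isClockwiseEdge hP hn')
      subst this
      injection e with e1 e2
      subst e1 e2 e'
      rw [ih hT hT']

end Geometry

/-! ### The comparison oracle -/

section Oracle

/-- The straight-line computation of the flag that tells whether the point whose index is in
quantum register `0` beats the point whose index is in classical register `8`, as seen from the
point whose index is in classical register `1`. The flag is computed in quantum register `24`. -/
def oracleOps : List (QOp 25) :=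
  [(1, .xCoord, .q 0, .q 0), (2, .yCoord, .q 0, .q 0), (3, .xCoord, .c 1, .c 1),
    (4, .yCoord, .c 1, .c 1), (5, .xCoord, .c 8, .c 8), (6, .yCoord, .c 8, .c 8),
    (7, .sub, .q 1, .q 3), (8, .sub, .q 2, .q 4), (9, .sub, .q 5, .q 3),
    (10, .sub, .q 6, .q 4), (11, .sub, .q 1, .q 5), (12, .sub, .q 2, .q 6),
    (13, .mul, .q 9, .q 8), (14, .mul, .q 10, .q 7), (15, .mul, .q 7, .q 11),
    (16, .mul, .q 8, .q 12), (17, .add, .q 15, .q 16), (18, .slt, .q 14, .q 13),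
    (19, .eq, .q 13, .q 14), (20, .slt, .c 3, .q 17), (21, .and, .q 19, .q 20),
    (22, .or, .q 18, .q 21), (23, .ult, .q 0, .c 0), (24, .and, .q 22, .q 23)]

/-- The test whether quantum register `0` is zero, computed in quantum register `1`. -/
def zeroOps : List (QOp 25) := [(1, .eq, .q 0, .c 3)]

theorem oracleOps_ne_zero : ∀ op ∈ oracleOps, op.1 ≠ 0 := by
  simp [oracleOps]

theorem zeroOps_ne_zero : ∀ op ∈ zeroOps, op.1 ≠ 0 := by
  simp [zeroOps]

variable {w m : ℕ}

/-- The indices of the points that beat `q` as seen from `p`. -/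
def beaters (P : Fin m → ℤ × ℤ) (p q : Fin m) : Finset (Fin m) :=
  Finset.univ.filter fun i => Beats (P p) (P q) (P i)

/-- The word that holds the index `i`. -/
def word (w : ℕ) (i : Fin m) : BitVec w := BitVec.ofNat w i

theorem toNat_word (hm : m ≤ 2 ^ w) (i : Fin m) : (word w i).toNat = i := by
  rw [word, BitVec.toNat_ofNat, Nat.mod_eq_of_lt (i.2.trans_le hm)]

theorem word_injective (hm : m ≤ 2 ^ w) : Function.Injective (word w : Fin m → BitVec w) :=
  fun i j h => by
    have := congrArg BitVec.toNat h
    rw [toNat_word hm, toNat_word hm] at this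
    exact Fin.ext this

/-- The words that hold the indices of the points that beat `q` as seen from `p`. -/
def marked (w : ℕ) (P : Fin m → ℤ × ℤ) (p q : Fin m) : Finset (BitVec w) :=
  (beaters P p q).image (word w)

theorem card_marked (hm : m ≤ 2 ^ w) (P : Fin m → ℤ × ℤ) (p q : Fin m) :
    (marked w P p q).card = (beaters P p q).card :=
  Finset.card_image_of_injective _ (word_injective hm)

theorem word_mem_marked (hm : m ≤ 2 ^ w) {P : Fin m → ℤ × ℤ} {p q i : Fin m} :
    word w i ∈ marked w P p q ↔ Beats (P p) (P q) (P i) := by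
  rw [marked, (word_injective hm).mem_finset_image]
  simp [beaters]

theorem tableOf_word (hm : m ≤ 2 ^ w) (P : Fin m → ℤ × ℤ) (i : Fin m) :
    tableOf w P (word w i) = (BitVec.ofInt w (P i).1, BitVec.ofInt w (P i).2) := by
  have h : (word w i).toNat < m := by rw [toNat_word hm]; exact i.2
  rw [tableOf, dif_pos h]
  have : (⟨(word w i).toNat, h⟩ : Fin m) = i := Fin.ext (toNat_word hm i)
  rw [this]

theorem ofInt_sub' (a b : ℤ) : BitVec.ofInt w a - BitVec.ofInt w b = BitVec.ofInt w (a - b) := by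
  rw [Int.sub_eq_add_neg, BitVec.ofInt_add, BitVec.ofInt_neg, BitVec.sub_eq_add_neg]

theorem toInt_ofInt_of_abs_lt {z : ℤ} {k : ℕ} (hk : k < w) (hz : |z| < 2 ^ k) :
    (BitVec.ofInt w z).toInt = z := by
  obtain ⟨n, rfl⟩ : ∃ n, w = n + 1 := ⟨w - 1, by omega⟩
  have h : (2 : ℤ) ^ k ≤ 2 ^ n := pow_le_pow_right₀ (by norm_num) (by omega)
  have h' := abs_lt.1 hz
  rw [BitVec.toInt_ofInt]
  refine Int.bmod_eq_of_le ?_ ?_ <;> push_cast <;> rw [pow_succ] <;> omega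

theorem runOps_zeroOps {D : Table w} {reg : ℕ → BitVec w} (h3 : reg 3 = 0) (x : BitVec w) :
    runOps D reg zeroOps (base x) 1 = if x = 0 then 1 else 0 := by
  have := runOps_spec (D := D) reg (l := zeroOps) (v := base x)
    (by simp [zeroOps, base]) (by simp [zeroOps, Arg.Avoids]) (by simp [zeroOps])
  have h0 : runOps D reg zeroOps (base x) 0 = x := by
    rw [runOps_of_forall_ne _ fun op h => (zeroOps_ne_zero op h).symm, base_zero_apply]
  generalize runOps D reg zeroOps (base x) = v at *
  simp [zeroOps, WordOp.eval, Arg.val, h0, h3] at this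
  simpa using this

/-- Differences are below `2 ^ (b + 1)` in absolute value, products below `2 ^ (2 * b + 2)` and the
inner product below `2 ^ (2 * b + 3)`, so modular arithmetic with signed comparison is exact.
Addresses beyond the input are rejected by the final conjunction. -/
theorem runOps_oracleOps {P : Fin m → ℤ × ℤ} {b : ℕ}
    (hb : ∀ i, |(P i).1| < 2 ^ b ∧ |(P i).2| < 2 ^ b) (hm : m < 2 ^ w) (hw : 2 * b + 3 < w)
    {reg : ℕ → BitVec w} {p q : Fin m} (h0 : reg 0 = BitVec.ofNat w m) (h1 : reg 1 = word w p)
    (h3 : reg 3 = 0) (h8 : reg 8 = word w q) (x : BitVec w) :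
    runOps (tableOf w P) reg oracleOps (base x) 24 = if x ∈ marked w P p q then 1 else 0 := by
  have hs := runOps_spec (D := tableOf w P) reg (l := oracleOps) (v := base x)
    (by simp [oracleOps, base]) (by simp [oracleOps, Arg.Avoids])
    (by simp [oracleOps, Arg.Avoids])
  have hv0 : runOps (tableOf w P) reg oracleOps (base x) 0 = x := by
    rw [runOps_of_forall_ne _ fun op h => (oracleOps_ne_zero op h).symm, base_zero_apply]
  generalize runOps (tableOf w P) reg oracleOps (base x) = v at *
  simp only [oracleOps, List.forall_mem_cons, WordOp.eval, Arg.val, hv0, h0, h1, h3, h8,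
    tableOf_word hm.le] at hs
  obtain ⟨e1, e2, e3, e4, e5, e6, e7, e8, e9, e10, e11, e12, e13, e14, e15, e16, e17, e18, e19,
    e20, e21, e22, e23, e24, -⟩ := hs
  by_cases hx : x.toNat < m
  · obtain ⟨i, rfl⟩ : ∃ i : Fin m, x = word w i :=
      ⟨⟨x.toNat, hx⟩, by simp [word]⟩
    rw [tableOf_word hm.le] at e1 e2
    simp only [word_mem_marked hm.le, e24, e23, e22, e21, e20, e19, e18, e17, e16, e15, e14,
      e13, e12, e11, e10, e9, e8, e7, e6, e5, e4, e3, e2, e1]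
    simp only [ofInt_sub', ← BitVec.ofInt_mul, ← BitVec.ofInt_add]
    have hd : ∀ i j : Fin m, |(P i).1 - (P j).1| < 2 ^ (b + 1) ∧
        |(P i).2 - (P j).2| < 2 ^ (b + 1) := fun i j => by
      have hi := hb i
      have hj := hb j
      simp only [abs_lt, pow_succ] at *
      omega
    have hmul : ∀ {y z : ℤ}, |y| < 2 ^ (b + 1) → |z| < 2 ^ (b + 1) →
        |y * z| < 2 ^ (2 * b + 2) := fun {y z} hy hz => by
      rw [abs_mul, show 2 * b + 2 = (b + 1) + (b + 1) by ring, pow_add]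
      exact mul_lt_mul'' hy hz (abs_nonneg _) (abs_nonneg _)
    have t1 := toInt_ofInt_of_abs_lt (show 2 * b + 2 < w by omega)
      (hmul (hd q p).1 (hd i p).2)
    have t2 := toInt_ofInt_of_abs_lt (show 2 * b + 2 < w by omega)
      (hmul (hd q p).2 (hd i p).1)
    have t3 := toInt_ofInt_of_abs_lt (w := w)
      (z := ((P i).1 - (P p).1) * ((P i).1 - (P q).1) + ((P i).2 - (P p).2) * ((P i).2 - (P q).2))
      hw (by
        refine (abs_add_le _ _).trans_lt ?_
        rw [pow_succ, mul_two]
        exact add_lt_add (hmul (hd i p).1 (hd i q).1) (hmul (hd i p).2 (hd i q).2))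
    have te := BitVec.toInt_inj (x := BitVec.ofInt w (((P q).1 - (P p).1) * ((P i).2 - (P p).2)))
      (y := BitVec.ofInt w (((P q).2 - (P p).2) * ((P i).1 - (P p).1)))
    rw [t1, t2] at te
    have t0 : (0 : BitVec w).toInt = 0 := by simp
    simp only [← te, t0, t1, t2, t3, toNat_word hm.le, BitVec.toNat_ofNat,
      Nat.mod_eq_of_lt hm, i.2, if_true, Beats, cross, sub_pos, sub_eq_zero]
    split_ifs <;> first | (exfalso; tauto) | simp
  · have hx' : x ∉ marked w P p q := by
      intro h
      obtain ⟨i, -, rfl⟩ := Finset.mem_image.1 h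
      exact hx (by rw [toNat_word hm.le]; exact i.2)
    rw [if_neg hx', e24, e23, BitVec.toNat_ofNat, Nat.mod_eq_of_lt hm, if_neg hx]
    simp

end Oracle

/-! ### The program -/

section Program

/-- The contents of the classical registers. -/
structure ClState (w : ℕ) where
  m : BitVec w
  p : BitVec w
  f : BitVec w
  one : BitVec w
  n : BitVec w
  size : BitVec w
  flag : BitVec w
  cur : BitVec w
  best : BitVec w
  rc : BitVec w
  sc : BitVec w
  j : BitVec w
  jc : BitVec w
  hc : BitVec w
  x : BitVec w
  fl : BitVec w
  bits : BitVec w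
  lit : BitVec w
  scales : BitVec w
  rounds : BitVec w

/-- The register file with given contents. -/
def ClState.reg {w : ℕ} (σ : ClState w) : ℕ → BitVec w
  | 0 => σ.m
  | 1 => σ.p
  | 2 => σ.f
  | 4 => σ.one
  | 5 => σ.n
  | 6 => σ.size
  | 7 => σ.flag
  | 8 => σ.cur
  | 9 => σ.best
  | 10 => σ.rc
  | 11 => σ.sc
  | 12 => σ.j
  | 13 => σ.jc
  | 14 => σ.hc
  | 15 => σ.x
  | 16 => σ.fl
  | 17 => σ.bits
  | 18 => σ.lit
  | 19 => σ.scales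
  | 20 => σ.rounds
  | _ => 0

namespace ClState

variable {w : ℕ} (σ : ClState w)

/-- Assignments become record updates, so the invariants can be read off by `rfl`. Register `3` has
no field and is therefore permanently zero; it serves as the constant `0`. -/
theorem update_reg {σ' : ClState w} {k : ℕ} {v : BitVec w} (h : σ'.reg k = v)
    (h' : ∀ i, i ≠ k → σ.reg i = σ'.reg i) : Function.update σ.reg k v = σ'.reg := by
  subst h
  funext i
  by_cases hi : i = k
  · subst hi; simp
  · rw [Function.update_of_ne hi, h' i hi]

theorem update_p (v : BitVec w) :
    Function.update σ.reg 1 v = { σ with p := v }.reg :=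
  σ.update_reg rfl fun i hi => by unfold reg; split <;> first | rfl | exact absurd rfl hi

theorem update_one (v : BitVec w) :
    Function.update σ.reg 4 v = { σ with one := v }.reg :=
  σ.update_reg rfl fun i hi => by unfold reg; split <;> first | rfl | exact absurd rfl hi

theorem update_n (v : BitVec w) :
    Function.update σ.reg 5 v = { σ with n := v }.reg :=
  σ.update_reg rfl fun i hi => by unfold reg; split <;> first | rfl | exact absurd rfl hi

theorem update_size (v : BitVec w) :
    Function.update σ.reg 6 v = { σ with size := v }.reg :=
  σ.update_reg rfl fun i hi => by unfold reg; split <;> first | rfl | exact absurd rfl hi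

theorem update_flag (v : BitVec w) :
    Function.update σ.reg 7 v = { σ with flag := v }.reg :=
  σ.update_reg rfl fun i hi => by unfold reg; split <;> first | rfl | exact absurd rfl hi

theorem update_cur (v : BitVec w) :
    Function.update σ.reg 8 v = { σ with cur := v }.reg :=
  σ.update_reg rfl fun i hi => by unfold reg; split <;> first | rfl | exact absurd rfl hi

theorem update_best (v : BitVec w) :
    Function.update σ.reg 9 v = { σ with best := v }.reg :=
  σ.update_reg rfl fun i hi => by unfold reg; split <;> first | rfl | exact absurd rfl hi

theorem update_rc (v : BitVec w) :
    Function.update σ.reg 10 v = { σ with rc := v }.reg :=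
  σ.update_reg rfl fun i hi => by unfold reg; split <;> first | rfl | exact absurd rfl hi

theorem update_sc (v : BitVec w) :
    Function.update σ.reg 11 v = { σ with sc := v }.reg :=
  σ.update_reg rfl fun i hi => by unfold reg; split <;> first | rfl | exact absurd rfl hi

theorem update_j (v : BitVec w) :
    Function.update σ.reg 12 v = { σ with j := v }.reg :=
  σ.update_reg rfl fun i hi => by unfold reg; split <;> first | rfl | exact absurd rfl hi

theorem update_jc (v : BitVec w) :
    Function.update σ.reg 13 v = { σ with jc := v }.reg :=
  σ.update_reg rfl fun i hi => by unfold reg; split <;> first | rfl | exact absurd rfl hi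

theorem update_x (v : BitVec w) :
    Function.update σ.reg 15 v = { σ with x := v }.reg :=
  σ.update_reg rfl fun i hi => by unfold reg; split <;> first | rfl | exact absurd rfl hi

theorem update_fl (v : BitVec w) :
    Function.update σ.reg 16 v = { σ with fl := v }.reg :=
  σ.update_reg rfl fun i hi => by unfold reg; split <;> first | rfl | exact absurd rfl hi

theorem update_bits (v : BitVec w) :
    Function.update σ.reg 17 v = { σ with bits := v }.reg :=
  σ.update_reg rfl fun i hi => by unfold reg; split <;> first | rfl | exact absurd rfl hi

theorem update_lit (v : BitVec w) :
    Function.update σ.reg 18 v = { σ with lit := v }.reg :=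
  σ.update_reg rfl fun i hi => by unfold reg; split <;> first | rfl | exact absurd rfl hi

theorem update_scales (v : BitVec w) :
    Function.update σ.reg 19 v = { σ with scales := v }.reg :=
  σ.update_reg rfl fun i hi => by unfold reg; split <;> first | rfl | exact absurd rfl hi

theorem update_rounds (v : BitVec w) :
    Function.update σ.reg 20 v = { σ with rounds := v }.reg :=
  σ.update_reg rfl fun i hi => by unfold reg; split <;> first | rfl | exact absurd rfl hi

end ClState

end Program

/-! ### Sampling a better point -/

section Sampling

/-- One Grover iteration. -/
def groverIter : Prog 25 :=
  block [phase oracleOps 24, hadamardProg, phase zeroOps 1, hadamardProg]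

/-- As many Grover iterations as register `12` says. -/
def groverLoop : Prog 25 :=
  block [.assign 13 .fst 12 12, .loop 13 (block [groverIter, .assign 13 .sub 13 4])]

/-- Prepare the uniform superposition and perform the Grover iterations. -/
def rotate : Prog 25 := block [hadamardProg, groverLoop]

/-- After the measurement of the index register: update the best index found so far if the outcome
is marked, and reset the registers. -/
def update : Prog 25 :=
  block [block (oracleOps.map QOp.prog), .measure 16 24, block (oracleOps.reverse.map QOp.prog),
    .apply 0 .fst (.c 15) (.c 15), .ite 16 (.assign 9 .fst 15 15) (block []),
    .assign 15 (.lit 0) 3 3, .assign 16 (.lit 0) 3 3]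

/-- One attempt to find an index that is better than the one in register `8`. -/
def attempt : Prog 25 := .seq rotate (.seq (.measure 15 0) update)

/-- The assumptions on the word length `w`, the input, the number `2 * r` of index bits and the
number `R` of rounds. -/
structure Env (w b r R : ℕ) {m : ℕ} (P : Fin m → ℤ × ℤ) : Prop where
  inj : Function.Injective P
  bound : ∀ i, |(P i).1| < 2 ^ b ∧ |(P i).2| < 2 ^ b
  lt_pow : m < 2 ^ w
  coord : 2 * b + 3 < w
  le_pow : m ≤ 2 ^ (2 * r)
  bits : 2 * r ≤ w
  scales : r + 1 < w
  rounds : R < 2 ^ w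

/-- The registers that keep their values during the search for the next vertex are set up, and
the scratch registers are cleared. -/
def Good {w : ℕ} (m r R : ℕ) (σ : ClState w) : Prop :=
  σ.m = BitVec.ofNat w m ∧ σ.one = 1 ∧ σ.bits = BitVec.ofNat w (2 * r) ∧
    σ.scales = BitVec.ofNat w (r + 1) ∧ σ.rounds = BitVec.ofNat w R ∧ σ.hc = 0 ∧ σ.jc = 0 ∧
    σ.x = 0 ∧ σ.fl = 0

/-- The initial state of the quantum registers. -/
noncomputable def zeroState (w : ℕ) : Basis 25 w → ℂ := embed base (Pi.single 0 1)

variable {w b r R m : ℕ} {P : Fin m → ℤ × ℤ} {D : Table w}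

theorem Runs.assign_of {σ σ' : ClState w} (x : ℕ) (o : WordOp) (y z : ℕ) (out : List (BitVec w))
    (ψ : Basis 25 w → ℂ)
    (h : Function.update σ.reg x (o.eval D (σ.reg y) (σ.reg z)) = σ'.reg) :
    Runs D (.assign x o y z) 1 ⟨σ.reg, out, ψ⟩ ⟨σ'.reg, out, ψ⟩ := by
  rw [← h]
  exact Runs.assign x o y z _

theorem getLsbD_zero_flag (hw : 0 < w) (p : Prop) [Decidable p] :
    (if p then 1 else 0 : BitVec w).getLsbD 0 = decide p := by
  by_cases h : p <;> simp [h, hw]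

theorem runs_groverIter (E : Env w b r R P) {σ : ClState w} {p q : Fin m}
    (h0 : σ.m = BitVec.ofNat w m) (h4 : σ.one = 1) (h17 : σ.bits = BitVec.ofNat w (2 * r))
    (h14 : σ.hc = 0) (hp : σ.p = word w p) (hq : σ.cur = word w q) (out : List (BitVec w))
    (a : BitVec w → ℂ) :
    Runs (tableOf w P) groverIter (24 * r + 129) ⟨σ.reg, out, embed base a⟩
      ⟨σ.reg, out, embed base (groverStep (2 * r) (marked w P p q) a)⟩ := by
  have hw : 0 < w := by have := E.coord; omega
  have h1 := Runs.phase (D := tableOf w P) oracleOps_ne_zero 24 hw (reg := σ.reg) rfl out a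
  simp only [runOps_oracleOps E.bound E.lt_pow E.coord (reg := σ.reg) h0 hp rfl hq,
    getLsbD_zero_flag hw, decide_eq_true_eq] at h1
  have h2 := Runs.hadamard (D := tableOf w P) (K := 25) E.bits (reg := σ.reg) h4 h14 h17 out
    (fun x => if x ∈ marked w P p q then -a x else a x)
  have h3 := Runs.phase (D := tableOf w P) zeroOps_ne_zero 1 hw (reg := σ.reg) rfl out
    (hadamardLow (2 * r) fun x => if x ∈ marked w P p q then -a x else a x)
  simp only [runOps_zeroOps (reg := σ.reg) rfl, getLsbD_zero_flag hw, decide_eq_true_eq] at h3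
  have h4 := Runs.hadamard (D := tableOf w P) (K := 25) E.bits (reg := σ.reg) h4 h14 h17 out
    (fun x => if x = 0 then
        -hadamardLow (2 * r) (fun x => if x ∈ marked w P p q then -a x else a x) x
      else hadamardLow (2 * r) (fun x => if x ∈ marked w P p q then -a x else a x) x)
  refine (Runs.block_cons h1 (Runs.block_cons h2 (Runs.block_cons h3 (Runs.block_cons h4
    (Runs.block_nil _))))).mono ?_
  simp only [oracleOps, zeroOps, List.length_cons, List.length_nil]
  omega

theorem runs_rotate (E : Env w b r R P) {σ : ClState w} (hσ : Good m r R σ) {p q : Fin m}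
    (hp : σ.p = word w p) (hq : σ.cur = word w q) {J : ℕ} (hJ : J < 2 ^ w)
    (hj : σ.j = BitVec.ofNat w J) (out : List (BitVec w)) :
    Runs (tableOf w P) rotate (J * (24 * r + 135) + 12 * r + 20) ⟨σ.reg, out, zeroState w⟩
      ⟨σ.reg, out, embed base ((groverStep (2 * r) (marked w P p q))^[J]
        (hadamardLow (2 * r) (Pi.single 0 1)))⟩ := by
  obtain ⟨h0, h4, h17, -, -, h14, h13, -, -⟩ := hσ
  set u : BitVec w → ℂ := hadamardLow (2 * r) (Pi.single 0 1) with hu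
  set G := groverStep (2 * r) (marked w P p q) with hG
  have h1 := Runs.hadamard (D := tableOf w P) (K := 25) E.bits (reg := σ.reg) h4 h14 h17 out
    (Pi.single 0 1)
  have h2 : Runs (tableOf w P) (.assign 13 .fst 12 12) 1 ⟨σ.reg, out, embed (K := 25) base u⟩
      ⟨{ σ with jc := BitVec.ofNat w J }.reg, out, embed base u⟩ :=
    Runs.assign_of 13 .fst 12 12 out _ (by
      rw [← hj]; exact σ.update_jc _)
  -- The memory when `k` iterations remain to be done.
  let ν : ℕ → Mem 25 w := fun k =>
    ⟨{ σ with jc := BitVec.ofNat w k }.reg, out, embed base (G^[J - k] u)⟩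
  have h3 := Runs.loop_count (D := tableOf w P) (x := 13) (ν := ν) (n := J)
    (p := block [groverIter, .assign 13 .sub 13 4]) (T := 24 * r + 133) rfl fun k hk => by
      refine ⟨ofNat_ne_zero (Nat.succ_ne_zero k) (by omega), ?_⟩
      have g1 := runs_groverIter E (σ := { σ with jc := BitVec.ofNat w (k + 1) }) h0 h4 h17 h14
        hp hq out (G^[J - (k + 1)] u)
      rw [← hG, ← Function.iterate_succ_apply' G,
        show (J - (k + 1)).succ = J - k by omega] at g1
      have g2 : Runs (tableOf w P) (.assign 13 .sub 13 4) 1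
          ⟨{ σ with jc := BitVec.ofNat w (k + 1) }.reg, out, embed (K := 25) base (G^[J - k] u)⟩
          ⟨{ σ with jc := BitVec.ofNat w k }.reg, out, embed base (G^[J - k] u)⟩ :=
        Runs.assign_of 13 .sub 13 4 out _ (by
          rw [← ofNat_succ_sub_one k, ← h4]
          exact ClState.update_jc { σ with jc := BitVec.ofNat w (k + 1) } _)
      exact (Runs.block_cons g1 (Runs.block_cons g2 (Runs.block_nil _))).mono (by omega)
  have e1 : ν J = ⟨{ σ with jc := BitVec.ofNat w J }.reg, out, embed base u⟩ := by
    simp [ν]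
  have e0 : ν 0 = ⟨σ.reg, out, embed base (G^[J] u)⟩ := by
    have : { σ with jc := BitVec.ofNat w 0 } = σ := by
      rw [show BitVec.ofNat w 0 = σ.jc from h13.symm]
    simp only [ν, this, Nat.sub_zero]
  rw [e1, e0] at h3
  refine (Runs.block_cons h1 (Runs.block_cons (Runs.block_cons h2 (Runs.block_cons h3
    (Runs.block_nil _))) (Runs.block_nil _))).mono ?_
  ring_nf
  omega

theorem runOps_congr {reg reg' : ℕ → BitVec w} {l : List (QOp 25)}
    (h : ∀ op ∈ l, ∀ v, op.2.2.1.val reg v = op.2.2.1.val reg' v ∧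
      op.2.2.2.val reg v = op.2.2.2.val reg' v) (v : Basis 25 w) :
    runOps D reg l v = runOps D reg' l v := by
  induction l generalizing v with
  | nil => rfl
  | cons op l ih =>
    have h' := h op List.mem_cons_self
    rw [runOps, runOps, ih fun op' hop' => h op' (List.mem_cons_of_mem _ hop')]
    simp only [applyBasis, (h' _).1, (h' _).2]

theorem embed_single (g : BitVec w → Basis 25 w) (hg : ∀ x, g x 0 = x) (a : BitVec w) :
    embed g (Pi.single a 1) = Pi.single (g a) 1 := by
  funext v
  unfold embed
  by_cases hv : v = g a
  · subst hv
    simp [hg]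
  · rw [Pi.single_eq_of_ne hv]
    split_ifs with h
    · rw [Pi.single_eq_of_ne]
      intro e
      rw [e] at h
      exact hv h
    · rfl

/-- Starts from the state collapsed to the measured index `a` and ends with all quantum registers
cleared, so that the next run of Grover search starts afresh. -/
theorem runs_update (E : Env w b r R P) {σ : ClState w} (hσ : Good m r R σ) {p q : Fin m}
    (hp : σ.p = word w p) (hq : σ.cur = word w q) (a : BitVec w) (out : List (BitVec w)) :
    Runs (tableOf w P) update 120
      ⟨{ σ with x := a }.reg, out, embed base (Pi.single a 1)⟩
      ⟨{ σ with best := if a ∈ marked w P p q then a else σ.best }.reg, out, zeroState w⟩ := by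
  obtain ⟨h0, h4, h17, -, -, h14, h13, h15, h16⟩ := hσ
  set M := marked w P p q
  set F : BitVec w := if a ∈ M then 1 else 0 with hF
  let σ1 : ClState w := { σ with x := a }
  let σ2 : ClState w := { σ with x := a, fl := F }
  have g1 := Runs.ops (D := tableOf w P) oracleOps_ne_zero σ1.reg out base (Pi.single a 1)
  have hfl : runOps (tableOf w P) σ1.reg oracleOps (base a) 24 = F :=
    runOps_oracleOps E.bound E.lt_pow E.coord (reg := σ1.reg) h0 hp rfl hq a
  have hg : ∀ x : BitVec w, runOps (tableOf w P) σ1.reg oracleOps (base x) 0 = x := fun x => by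
    rw [runOps_of_forall_ne _ fun op h => (oracleOps_ne_zero op h).symm, base_zero_apply]
  -- The state is a single basis state, so the outcome `F` is certain. The oracle does not read
  -- register `16`, hence it can still be uncomputed after this write.
  have g2 := Runs.measure (D := tableOf w P) 16 24 F ⟨σ1.reg, out,
    embed (fun x => runOps (tableOf w P) σ1.reg oracleOps (base x)) (Pi.single a 1)⟩
  have e2 : (fun v => if v 24 = F then
      embed (fun x => runOps (tableOf w P) σ1.reg oracleOps (base x)) (Pi.single a 1) v else 0) =
      embed (fun x => runOps (tableOf w P) σ2.reg oracleOps (base x)) (Pi.single a 1) := by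
    have : ∀ v, runOps (tableOf w P) σ1.reg oracleOps v =
        runOps (tableOf w P) σ2.reg oracleOps v :=
      runOps_congr (by simp [oracleOps, Arg.val, σ1, σ2, ClState.reg])
    simp only [← this]
    rw [embed_single _ hg]
    funext v
    by_cases hv : v = runOps (tableOf w P) σ1.reg oracleOps (base a)
    · rw [hv, if_pos hfl]
    · rw [Pi.single_eq_of_ne hv, ite_self]
  dsimp only at g2
  rw [e2, σ1.update_fl] at g2
  have g3 := Runs.ops_reverse (D := tableOf w P) oracleOps_ne_zero σ2.reg out base (Pi.single a 1)
  have g4 := Runs.apply (D := tableOf w P) 0 .fst (.c 15) (.c 15)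
    ⟨σ2.reg, out, embed (K := 25) base (Pi.single a 1)⟩
  -- The classical copy of the outcome, XORed into the index register, resets it to zero.
  have e4 : (fun v => embed (K := 25) base (Pi.single a 1 : BitVec w → ℂ)
      (applyBasis (tableOf w P) σ2.reg 0 .fst (.c 15) (.c 15) v)) = zeroState w := by
    rw [zeroState, embed_single _ base_zero_apply, embed_single _ base_zero_apply]
    funext v
    have : applyBasis (tableOf w P) σ2.reg 0 .fst (.c 15) (.c 15) v = base a ↔ v = base 0 := by
      rw [applyBasis_eq_iff]
      have h' : applyBasis (tableOf w P) σ2.reg 0 .fst (.c 15) (.c 15) (base a) =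
          (base 0 : Basis 25 w) := by
        simp [applyBasis, WordOp.eval, Arg.val, ClState.reg, σ2, base]
      rw [h']
    simp only [Pi.single_apply, this]
  dsimp only at g4
  rw [e4] at g4
  let σ3 : ClState w := { σ2 with best := if a ∈ M then a else σ.best }
  have g5 : Runs (tableOf w P) (.ite 16 (.assign 9 .fst 15 15) (block [])) 2
      ⟨σ2.reg, out, zeroState w⟩ ⟨σ3.reg, out, zeroState w⟩ := by
    by_cases ha : a ∈ M
    · have e : σ3 = { σ2 with best := a } := by simp only [σ3, if_pos ha]
      rw [e]
      refine Runs.ite_true ?_ (Runs.assign_of 9 .fst 15 15 out _ (σ2.update_best _))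
      change F ≠ 0
      rw [hF, if_pos ha]
      have : 0 < w := by have := E.coord; omega
      exact ofNat_ne_zero one_ne_zero (Nat.one_lt_two_pow this.ne')
    · have e : σ3 = σ2 := by simp only [σ3, if_neg ha, σ2]
      rw [e]
      refine Runs.ite_false ?_ (Runs.block_nil _)
      change F = 0
      rw [hF, if_neg ha]
  have g6 : Runs (tableOf w P) (.assign 15 (.lit 0) 3 3) 1 ⟨σ3.reg, out, zeroState w⟩
      ⟨{ σ3 with x := 0 }.reg, out, zeroState w⟩ :=
    Runs.assign_of 15 (.lit 0) 3 3 out _ (σ3.update_x _)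
  have g7 : Runs (tableOf w P) (.assign 16 (.lit 0) 3 3) 1
      ⟨{ σ3 with x := 0 }.reg, out, zeroState w⟩
      ⟨{ σ3 with x := 0, fl := 0 }.reg, out, zeroState w⟩ :=
    Runs.assign_of 16 (.lit 0) 3 3 out _ (ClState.update_fl { σ3 with x := 0 } _)
  have e7 : ({ σ3 with x := 0, fl := 0 } : ClState w) =
      { σ with best := if a ∈ M then a else σ.best } := by
    simp only [σ3, σ2, h15, h16]
  rw [e7] at g7
  refine (Runs.block_cons g1 (Runs.block_cons g2 (Runs.block_cons g3 (Runs.block_cons g4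
    (Runs.block_cons g5 (Runs.block_cons g6 (Runs.block_cons g7 (Runs.block_nil _)))))))).mono ?_
  simp [oracleOps]

theorem marked_subset_low (E : Env w b r R P) (p q : Fin m) :
    marked w P p q ⊆ low w (2 * r) := by
  intro x hx
  obtain ⟨i, -, rfl⟩ := Finset.mem_image.1 hx
  rw [mem_low, toNat_word E.lt_pow.le]
  exact i.2.trans_le E.le_pow

theorem card_beaters_lt (E : Env w b r R P) (p q : Fin m) :
    (beaters P p q).card < 2 ^ (2 * r) := by
  refine lt_of_lt_of_le ?_ E.le_pow
  have : (beaters P p q).card < (Finset.univ : Finset (Fin m)).card :=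
    Finset.card_lt_card (Finset.filter_ssubset.2 ⟨q, Finset.mem_univ q, beats_irrefl _ _⟩)
  simpa using this

/-- An attempt with `J` Grover iterations finds a better index with probability
`sin ((2 J + 1) θ) ^ 2`, and then every better index is equally likely. -/
theorem haltProb_attempt (E : Env w b r R P) {σ : ClState w} (hσ : Good m r R σ) {p q z : Fin m}
    (hp : σ.p = word w p) (hq : σ.cur = word w q) (hz : σ.best = word w z) {J : ℕ}
    (hJ : J < 2 ^ w) (hj : σ.j = BitVec.ofNat w J) {out target : List (BitVec w)} {t : ℕ}
    {S : List (Prog 25)} {g : Fin m → ℝ}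
    (hg : ∀ y, g y ≤ haltProb (tableOf w P) target t S
      ⟨{ σ with best := word w y }.reg, out, zeroState w⟩) :
    Real.sin ((2 * J + 1) * groverAngle (beaters P p q).card (2 ^ (2 * r))) ^ 2 /
          (beaters P p q).card * ∑ i ∈ beaters P p q, g i +
        Real.cos ((2 * J + 1) * groverAngle (beaters P p q).card (2 ^ (2 * r))) ^ 2 * g z ≤
      haltProb (tableOf w P) target (t + (J + 1) * (24 * r + 200)) (attempt :: S)
        ⟨σ.reg, out, zeroState w⟩ := by
  have hm := E.lt_pow.le
  set M := marked w P p q with hM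
  set ψ := (groverStep (2 * r) M)^[J] (hadamardLow (2 * r) (Pi.single 0 1)) with hψ
  have hcard : M.card = (beaters P p q).card := card_marked hm P p q
  have h1 := runs_rotate E hσ hp hq hJ hj out
  let f : BitVec w → ℝ := fun x => haltProb (tableOf w P) target t S
    ⟨{ σ with best := x }.reg, out, zeroState w⟩
  have h2 : ∑ x, ‖ψ x‖ ^ 2 * (if x ∈ M then f x else f (word w z)) ≤
      haltProb (tableOf w P) target (t + 120 + 1) (.measure 15 0 :: update :: S)
        ⟨σ.reg, out, embed base ψ⟩ := by
    rw [haltProb]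
    refine Finset.sum_le_sum fun a _ => ?_
    -- After the outcome `a` the state is `ψ a` times a basis state; `haltProb_smul` extracts the
    -- probability `‖ψ a‖ ^ 2`.
    have e : (fun v => if v 0 = a then embed (K := 25) base ψ v else 0) =
        fun v => ψ a * embed (K := 25) base (Pi.single a 1) v := by
      funext v
      unfold embed
      by_cases hv : v = base (v 0)
      · by_cases ha : v 0 = a
        · rw [if_pos ha, if_pos hv, if_pos hv, ha, Pi.single_eq_same, mul_one]
        · rw [if_neg ha, if_pos hv, Pi.single_eq_of_ne ha, mul_zero]
      · rw [if_neg hv, if_neg hv, ite_self, mul_zero]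
    dsimp only
    rw [e, haltProb_smul (μ := ⟨Function.update σ.reg 15 a, out, embed base (Pi.single a 1)⟩),
      σ.update_x]
    refine mul_le_mul_of_nonneg_left ?_ (by positivity)
    refine le_trans (le_of_eq ?_) (runs_update E hσ hp hq a out target S t)
    rw [← hz]
    simp only [f]
    split_ifs <;> rfl
  have h3 : haltProb (tableOf w P) target (t + 120 + 1) (.measure 15 0 :: update :: S)
        ⟨σ.reg, out, embed base ψ⟩ ≤
      haltProb (tableOf w P) target (t + (J + 1) * (24 * r + 200)) (attempt :: S)
        ⟨σ.reg, out, zeroState w⟩ := by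
    refine le_trans ?_ (haltProb_mono (t := t + 120 + 1 + 1 +
      (J * (24 * r + 135) + 12 * r + 20) + 1) (by linarith) _ _)
    conv_rhs => rw [attempt, haltProb]
    refine le_trans (le_of_eq ?_) (h1 target _ _)
    conv_rhs => rw [haltProb]
  refine le_trans ?_ (h2.trans h3)
  rw [sum_groverStep_iterate E.bits (marked_subset_low E p q)
    (by rw [hcard]; exact card_beaters_lt E p q), hcard]
  refine add_le_add (mul_le_mul_of_nonneg_left ?_ (by positivity))
    (mul_le_mul_of_nonneg_left (hg z) (by positivity))
  rw [marked, Finset.sum_image fun x _ y _ h => word_injective hm h]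
  exact Finset.sum_le_sum fun i _ => hg i

end Sampling

/-! ### The search for the next vertex, and the walk along the hull -/

section Search

/-- The attempts with `2 ^ i - 1` Grover iterations, for growing `i`. -/
def scaleBody : Prog 25 :=
  block [attempt, .assign 12 .add 12 12, .assign 12 .add 12 4, .assign 11 .sub 11 4]

/-- A sweep over all scales. -/
def sweep : Prog 25 :=
  block [.assign 9 .fst 8 8, .assign 11 .fst 19 19, .loop 11 scaleBody, .assign 8 .fst 9 9,
    .assign 12 (.lit 0) 3 3]

/-- The body of the loop over the rounds. -/
def roundBody : Prog 25 := block [sweep, .assign 10 .sub 10 4]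

/-- The search for the clockwise neighbour of a hull vertex. -/
def search : Prog 25 :=
  block [.assign 8 .fst 1 1, .assign 9 .fst 1 1, .assign 10 .fst 20 20, .loop 10 roundBody]

/-- One step of the walk along the hull. -/
def walkBody : Prog 25 :=
  block [search, .assign 1 .fst 8 8, .emit 1, .assign 7 .sub 1 2]

variable {w b r R m : ℕ} {P : Fin m → ℤ × ℤ} {D : Table w} {target : List (BitVec w)}

theorem haltProb_block_cons {K t : ℕ} {p : Prog K} {ps S : List (Prog K)} {μ : Mem K w} :
    haltProb D target (t + 1) (block (p :: ps) :: S) μ =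
      haltProb D target t (p :: block ps :: S) μ := by
  rw [block, haltProb]

theorem Runs.le_block_cons {K t T : ℕ} {p : Prog K} {ps S : List (Prog K)} {μ μ' : Mem K w}
    (h : Runs D p T μ μ') : haltProb D target t (block ps :: S) μ' ≤
      haltProb D target (t + T + 1) (block (p :: ps) :: S) μ := by
  rw [haltProb_block_cons]
  exact h target _ _

theorem le_loop {K t x : ℕ} {p : Prog K} {S : List (Prog K)} {μ : Mem K w} (h : μ.reg x ≠ 0) :
    haltProb D target t (p :: .loop x p :: S) μ ≤
      haltProb D target (t + 1) (.loop x p :: S) μ := by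
  conv_rhs => rw [haltProb, if_pos h]

/-- The probability that `k` attempts, beginning with scale `i`, all fail. -/
noncomputable def scaleFail (θ : ℝ) : ℕ → ℕ → ℝ
  | 0, _ => 1
  | k + 1, i => Real.cos ((2 * ((2 ^ i - 1 : ℕ) : ℝ) + 1) * θ) ^ 2 * scaleFail θ k (i + 1)

theorem scaleFail_nonneg (θ : ℝ) (k i : ℕ) : 0 ≤ scaleFail θ k i := by
  induction k generalizing i with
  | zero => exact zero_le_one
  | succ k ih => exact mul_nonneg (sq_nonneg _) (ih _)

theorem scaleFail_le_one (θ : ℝ) (k i : ℕ) : scaleFail θ k i ≤ 1 := by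
  induction k generalizing i with
  | zero => exact le_rfl
  | succ k ih => exact mul_le_one₀ (Real.cos_sq_le_one _) (scaleFail_nonneg _ _ _) (ih _)

theorem scaleFail_le_half {θ : ℝ} {k i l : ℕ} (h1 : i ≤ l) (h2 : l < i + k)
    (h : 1 / 2 ≤ Real.sin ((2 * ((2 ^ l - 1 : ℕ) : ℝ) + 1) * θ) ^ 2) :
    scaleFail θ k i ≤ 1 / 2 := by
  induction k generalizing i with
  | zero => omega
  | succ k ih =>
    rw [scaleFail]
    have h3 := scaleFail_nonneg θ k (i + 1)
    have h4 := scaleFail_le_one θ k (i + 1)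
    rcases eq_or_lt_of_le h1 with rfl | h1
    · rw [Real.cos_sq']
      nlinarith
    · have := ih h1 (by omega)
      have h5 := Real.cos_sq_le_one ((2 * ((2 ^ i - 1 : ℕ) : ℝ) + 1) * θ)
      nlinarith

/-- A bound for the cost of `k` attempts, beginning with scale `i`. -/
def scaleCost (X : ℕ) : ℕ → ℕ → ℕ
  | 0, _ => 1
  | k + 1, i => 2 ^ i * X + scaleCost X k (i + 1)

/-- A geometric sum: a whole sweep costs only a constant times its largest scale. -/
theorem scaleCost_add (X k i : ℕ) : scaleCost X k i + 2 ^ i * X = 2 ^ (i + k) * X + 1 := by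
  induction k generalizing i with
  | zero => rw [scaleCost, add_zero, add_comm]
  | succ k ih =>
    have := ih (i + 1)
    rw [show i + 1 + k = i + (k + 1) by ring, pow_succ] at this
    rw [scaleCost]
    linarith

/-- For `t = 0` the angle vanishes, so the division by zero is harmless. -/
theorem sin_sq_div_mul (x : ℝ) (t N : ℕ) :
    Real.sin (x * groverAngle t N) ^ 2 / t * t = Real.sin (x * groverAngle t N) ^ 2 := by
  rcases Nat.eq_zero_or_pos t with rfl | ht
  · simp [groverAngle]
  · have : (t : ℝ) ≠ 0 := by exact_mod_cast ht.ne'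
    field_simp

/-- Register `8` stays at `q` during a sweep, so every success draws uniformly from the same set and
simply overwrites the previous find. The continuation is thus worth `avg` unless all scales fail. -/
theorem haltProb_scales (E : Env w b r R P) {p q : Fin m} {g : Fin m → ℝ} {avg : ℝ}
    (havg : ∑ i ∈ beaters P p q, g i = (beaters P p q).card * avg) {t : ℕ}
    {S : List (Prog 25)} {out : List (BitVec w)} (k i : ℕ) (hki : i + k = r + 1)
    {σ : ClState w} (hσ : Good m r R σ) (hp : σ.p = word w p) (hq : σ.cur = word w q)
    {z : Fin m} (hz : σ.best = word w z) (hsc : σ.sc = BitVec.ofNat w k)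
    (hj : σ.j = BitVec.ofNat w (2 ^ i - 1))
    (hg : ∀ y, g y ≤ haltProb (tableOf w P) target t S
      ⟨{ σ with best := word w y, sc := 0, j := BitVec.ofNat w (2 ^ (r + 1) - 1) }.reg, out,
        zeroState w⟩) :
    scaleFail (groverAngle (beaters P p q).card (2 ^ (2 * r))) k i * g z +
        (1 - scaleFail (groverAngle (beaters P p q).card (2 ^ (2 * r))) k i) * avg ≤
      haltProb (tableOf w P) target (t + scaleCost (24 * r + 210) k i)
        (.loop 11 scaleBody :: S) ⟨σ.reg, out, zeroState w⟩ := by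
  induction k generalizing σ i z with
  | zero =>
    rw [scaleFail, scaleCost]
    refine le_trans ?_ (Runs.loop_done (x := 11) (p := scaleBody) (by exact hsc) target S t)
    have := hg z
    rw [← hz, show (0 : BitVec w) = σ.sc from hsc.symm, ← (by omega : i = r + 1), ← hj] at this
    linarith
  | succ k ih =>
    set θ := groverAngle (beaters P p q).card (2 ^ (2 * r)) with hθ
    set π := scaleFail θ k (i + 1) with hπ
    have hw := E.scales
    have hi : 2 ^ i < 2 ^ w := Nat.pow_lt_pow_right (by norm_num) (by omega)
    have hi1 : 1 ≤ 2 ^ i := Nat.one_le_two_pow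
    have h1w : 2 ^ 0 < 2 ^ w := Nat.pow_lt_pow_right (by norm_num) (by omega)
    have h4 : σ.one = 1 := hσ.2.1
    -- The value passed back through the remaining scales, `π * g y + (1 - π) * avg`, has the same
    -- average `avg` over the better points.
    have key := haltProb_attempt E hσ hp hq hz (J := 2 ^ i - 1) (by omega) hj (out := out)
      (target := target) (t := t + scaleCost (24 * r + 210) k (i + 1) + 7)
      (S := block [.assign 12 .add 12 12, .assign 12 .add 12 4, .assign 11 .sub 11 4] ::
        .loop 11 scaleBody :: S)
      (g := fun y => π * g y + (1 - π) * avg) fun y => by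
        let σ1 : ClState w := { σ with best := word w y }
        let σ2 : ClState w := { σ1 with j := σ.j + σ.j }
        let σ3 : ClState w := { σ1 with j := BitVec.ofNat w (2 ^ (i + 1) - 1) }
        let σ4 : ClState w := { σ3 with sc := BitVec.ofNat w k }
        have s1 : Runs (tableOf w P) (.assign 12 .add 12 12) 1 ⟨σ1.reg, out, zeroState w⟩
            ⟨σ2.reg, out, zeroState w⟩ :=
          Runs.assign_of 12 .add 12 12 out _ (σ1.update_j _)
        have s2 : Runs (tableOf w P) (.assign 12 .add 12 4) 1 ⟨σ2.reg, out, zeroState w⟩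
            ⟨σ3.reg, out, zeroState w⟩ :=
          Runs.assign_of 12 .add 12 4 out _ (by
            simp only [σ3]
            rw [show 2 ^ (i + 1) - 1 = (2 ^ i - 1) + (2 ^ i - 1) + 1 by rw [pow_succ]; omega,
              BitVec.ofNat_add, BitVec.ofNat_add, ← hj,
              show BitVec.ofNat w 1 = σ.one from h4.symm]
            exact σ2.update_j _)
        have s3 : Runs (tableOf w P) (.assign 11 .sub 11 4) 1 ⟨σ3.reg, out, zeroState w⟩
            ⟨σ4.reg, out, zeroState w⟩ :=
          Runs.assign_of 11 .sub 11 4 out _ (by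
            simp only [σ4]
            rw [← ofNat_succ_sub_one k, ← hsc, ← h4]
            exact σ3.update_sc _)
        have s := Runs.block_cons s1 (Runs.block_cons s2 (Runs.block_cons s3 (Runs.block_nil _)))
        refine le_trans ?_ (s target _ _)
        exact ih (i + 1) (by omega) (σ := σ4) hσ hp hq rfl rfl rfl hg
    rw [← hθ] at key
    refine le_trans (le_of_eq ?_) (key.trans ((haltProb_mono (t' := t + scaleCost (24 * r + 210) k
      (i + 1) + 2 ^ i * (24 * r + 210) - 2) ?_ _ _).trans ?_))
    · rw [scaleFail, ← hπ, Finset.sum_add_distrib, ← Finset.mul_sum, havg, Finset.sum_const,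
        nsmul_eq_mul]
      have e1 := sin_sq_div_mul (2 * ((2 ^ i - 1 : ℕ) : ℝ) + 1) (beaters P p q).card (2 ^ (2 * r))
      rw [← hθ] at e1
      have e2 := Real.sin_sq_add_cos_sq ((2 * ((2 ^ i - 1 : ℕ) : ℝ) + 1) * θ)
      linear_combination -avg * e1 - avg * e2
    · rw [Nat.sub_add_cancel hi1]
      have : 2 ^ i * (24 * r + 210) = 2 ^ i * (24 * r + 200) + 2 ^ i * 10 := by ring
      omega
    · have h210 : 2 ≤ 2 ^ i * (24 * r + 210) := by nlinarith
      rw [scaleCost, show t + (2 ^ i * (24 * r + 210) + scaleCost (24 * r + 210) k (i + 1)) =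
        (t + scaleCost (24 * r + 210) k (i + 1) + 2 ^ i * (24 * r + 210) - 2) + 1 + 1 by omega]
      refine (le_of_eq haltProb_block_cons.symm).trans (le_loop ?_)
      change σ.sc ≠ 0
      rw [hsc]
      exact ofNat_ne_zero (Nat.succ_ne_zero k) ((show k + 1 < w by omega).trans Nat.lt_two_pow_self)

/-- The sum of the ranks counts comparable ordered pairs, and at most one of `(i, j)`, `(j, i)` is
counted. -/
theorem two_mul_sum_card_beaters_le (hP : Function.Injective P) {p : Fin m}
    (hp : IsHullVertex P p) (q : Fin m) :
    2 * ∑ i ∈ beaters P p q, (beaters P p i).card ≤ (beaters P p q).card ^ 2 := by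
  set B := beaters P p q with hB
  have h1 : ∀ i ∈ B, (beaters P p i).card =
      ∑ j ∈ B, if Beats (P p) (P i) (P j) then 1 else 0 := fun i hi => by
    rw [Finset.sum_boole, Nat.cast_id]
    congr 1
    ext j
    simp only [hB, beaters, Finset.mem_filter, Finset.mem_univ, true_and] at hi ⊢
    exact ⟨fun h => ⟨beats_trans hP hp hi h, h⟩, fun h => h.2⟩
  have h2 : ∑ i ∈ B, (beaters P p i).card =
      ∑ i ∈ B, ∑ j ∈ B, if Beats (P p) (P i) (P j) then 1 else 0 := Finset.sum_congr rfl h1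
  calc 2 * ∑ i ∈ B, (beaters P p i).card
      = ∑ i ∈ B, ∑ j ∈ B, ((if Beats (P p) (P i) (P j) then 1 else 0) +
          if Beats (P p) (P j) (P i) then 1 else 0) := by
        simp only [Finset.sum_add_distrib]
        rw [two_mul, h2]
        congr 1
        exact Finset.sum_comm
    _ ≤ ∑ i ∈ B, ∑ j ∈ B, 1 := by
        refine Finset.sum_le_sum fun i _ => Finset.sum_le_sum fun j _ => ?_
        by_cases hij : Beats (P p) (P i) (P j)
        · have : ¬ Beats (P p) (P j) (P i) := fun h => beats_irrefl _ _ (beats_trans hP hp hij h)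
          simp [this, hij]
        · simp only [hij, if_false, zero_add]
          split_ifs <;> omega
    _ = B.card ^ 2 := by simp [sq]

/-- Bounds affine in the rank are preserved. With failure probability `π ≤ 1/2` the expected rank
shrinks by `π + (1 - π) / 2 ≤ 3/4`. -/
theorem haltProb_sweep (E : Env w b r R P) {σ : ClState w} (hσ : Good m r R σ) {p q : Fin m}
    (hv : IsHullVertex P p) (hp : σ.p = word w p) (hq : σ.cur = word w q) (hj : σ.j = 0)
    {t : ℕ} {S : List (Prog 25)} {out : List (BitVec w)} {A β : ℝ} (hβ : 0 ≤ β)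
    (hg : ∀ y, A - β * (beaters P p y).card ≤ haltProb (tableOf w P) target t S
      ⟨{ σ with cur := word w y, best := word w y, sc := 0, j := 0 }.reg, out, zeroState w⟩) :
    A - 3 / 4 * β * (beaters P p q).card ≤
      haltProb (tableOf w P) target (t + 2 ^ (r + 1) * (24 * r + 230)) (sweep :: S)
        ⟨σ.reg, out, zeroState w⟩ := by
  set B := beaters P p q with hB
  set g : Fin m → ℝ := fun y => A - β * (beaters P p y).card with hgdef
  have hsum : (∑ i ∈ B, ((beaters P p i).card : ℝ)) ≤ (B.card : ℝ) ^ 2 / 2 := by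
    have := two_mul_sum_card_beaters_le E.inj hv q
    rw [← hB] at this
    have h' : (2 : ℝ) * ∑ i ∈ B, ((beaters P p i).card : ℝ) ≤ (B.card : ℝ) ^ 2 := by
      exact_mod_cast this
    linarith
  obtain ⟨avg, havg, hle⟩ : ∃ avg : ℝ, ∑ i ∈ B, g i = B.card * avg ∧
      A - β * B.card / 2 ≤ avg := by
    rcases B.eq_empty_or_nonempty with h | h
    -- If nothing beats `q`, any average satisfies the equation; `A` also satisfies the inequality.
    · exact ⟨A, by simp [h], by simp [h]⟩
    · have hc : (0 : ℝ) < B.card := by exact_mod_cast h.card_pos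
      refine ⟨(∑ i ∈ B, g i) / B.card, by field_simp, ?_⟩
      rw [le_div_iff₀ hc, hgdef, Finset.sum_sub_distrib, Finset.sum_const, nsmul_eq_mul,
        ← Finset.mul_sum]
      nlinarith
  let σ1 : ClState w := { σ with best := word w q }
  let σ2 : ClState w := { σ1 with sc := BitVec.ofNat w (r + 1) }
  have s1 : Runs (tableOf w P) (.assign 9 .fst 8 8) 1 ⟨σ.reg, out, zeroState w⟩
      ⟨σ1.reg, out, zeroState w⟩ :=
    Runs.assign_of 9 .fst 8 8 out _ (by
      simp only [σ1, ← hq]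
      exact σ.update_best _)
  have s2 : Runs (tableOf w P) (.assign 11 .fst 19 19) 1 ⟨σ1.reg, out, zeroState w⟩
      ⟨σ2.reg, out, zeroState w⟩ :=
    Runs.assign_of 11 .fst 19 19 out _ (by
      have h19 : σ.scales = _ := hσ.2.2.2.1
      simp only [σ2, ← h19]
      exact σ1.update_sc _)
  have key := haltProb_scales E havg (target := target) (t := t + 5)
    (S := block [.assign 8 .fst 9 9, .assign 12 (.lit 0) 3 3] :: S) (out := out) (r + 1) 0
    (by omega) (σ := σ2) hσ hp hq rfl rfl hj fun y => by
      let σ3 : ClState w :=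
        { σ2 with best := word w y, sc := 0, j := BitVec.ofNat w (2 ^ (r + 1) - 1) }
      have s3 : Runs (tableOf w P) (.assign 8 .fst 9 9) 1 ⟨σ3.reg, out, zeroState w⟩
          ⟨{ σ3 with cur := word w y }.reg, out, zeroState w⟩ :=
        Runs.assign_of 8 .fst 9 9 out _ (σ3.update_cur _)
      have s4 : Runs (tableOf w P) (.assign 12 (.lit 0) 3 3) 1
          ⟨{ σ3 with cur := word w y }.reg, out, zeroState w⟩
          ⟨{ σ3 with cur := word w y, j := 0 }.reg, out, zeroState w⟩ :=
        Runs.assign_of 12 (.lit 0) 3 3 out _ (ClState.update_j { σ3 with cur := word w y } _)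
      exact (hg y).trans
        ((Runs.block_cons s3 (Runs.block_cons s4 (Runs.block_nil _))) target S t)
  set π := scaleFail (groverAngle B.card (2 ^ (2 * r))) (r + 1) 0 with hπ
  have hπ0 : 0 ≤ π := scaleFail_nonneg _ _ _
  have hπ1 : π ≤ 1 := scaleFail_le_one _ _ _
  have hcost := scaleCost_add (24 * r + 210) (r + 1) 0
  refine le_trans ?_ (key.trans ?_)
  · have h1 : π * g q + (1 - π) * (A - β * B.card / 2) ≤ π * g q + (1 - π) * avg := by
      have := mul_le_mul_of_nonneg_left hle (sub_nonneg.2 hπ1)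
      linarith
    refine le_trans ?_ h1
    have hgq : g q = A - β * B.card := rfl
    rw [hgq]
    rcases B.eq_empty_or_nonempty with h | h
    · simp only [h, Finset.card_empty, Nat.cast_zero]
      exact le_of_eq (by ring)
    · have hc : (0 : ℝ) < B.card := by exact_mod_cast h.card_pos
      obtain ⟨i, hi, hs⟩ := exists_half_le_sin_sq
        (one_le_mul_groverAngle h.card_pos (card_beaters_lt E p q)) (groverAngle_le _ _)
      have hhalf : π ≤ 1 / 2 := scaleFail_le_half (Nat.zero_le i) (by omega) hs
      have h2 := mul_nonneg (mul_nonneg hβ hc.le) (sub_nonneg.2 hhalf)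
      clear key hcost
      linear_combination h2 / 2
  · rw [pow_zero, one_mul, zero_add] at hcost
    refine ((le_of_eq haltProb_block_cons.symm).trans (s2.le_block_cons.trans
      s1.le_block_cons)).trans (haltProb_mono ?_ _ _)
    have : 1 ≤ 2 ^ (r + 1) := Nat.one_le_two_pow
    have e : 2 ^ (r + 1) * (24 * r + 230) =
        2 ^ (r + 1) * (24 * r + 210) + 2 ^ (r + 1) * 20 := by ring
    omega

end Search

/-! ### Geometric decay over the rounds, the search for one edge, and the whole walk -/

section Walk

variable {w b r R m : ℕ} {P : Fin m → ℤ × ℤ} {target : List (BitVec w)}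

theorem ClState.eq_of_cur_best (σ : ClState w) {u : BitVec w} (h : σ.cur = u) (h' : σ.best = u) :
    { σ with cur := u, best := u } = σ := by
  cases σ
  simp only at h h'
  subst h
  subst h'
  rfl

theorem haltProb_rounds (E : Env w b r R P) {p : Fin m} (hv : IsHullVertex P p) {t : ℕ}
    {S : List (Prog 25)} {out : List (BitVec w)} {A β : ℝ} (hβ : 0 ≤ β) (k : ℕ) (hk : k < 2 ^ w)
    {σ : ClState w} (hσ : Good m r R σ) (hp : σ.p = word w p) {q : Fin m}
    (hq : σ.cur = word w q) (hz : σ.best = word w q) (hj : σ.j = 0) (hsc : σ.sc = 0)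
    (hrc : σ.rc = BitVec.ofNat w k)
    (hg : ∀ y, A - β * (beaters P p y).card ≤ haltProb (tableOf w P) target t S
      ⟨{ σ with cur := word w y, best := word w y, rc := 0 }.reg, out, zeroState w⟩) :
    A - (3 / 4) ^ k * β * (beaters P p q).card ≤
      haltProb (tableOf w P) target (t + k * (2 ^ (r + 1) * (24 * r + 240)) + 1)
        (.loop 10 roundBody :: S) ⟨σ.reg, out, zeroState w⟩ := by
  induction k generalizing σ q with
  | zero =>
    rw [pow_zero, one_mul, zero_mul, add_zero]
    refine le_trans ?_ (Runs.loop_done (x := 10) (p := roundBody) (by exact hrc) target S t)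
    have := hg q
    rw [show (0 : BitVec w) = σ.rc from hrc.symm] at this
    rwa [show ({ σ with cur := word w q, best := word w q, rc := σ.rc } : ClState w) = σ from
      σ.eq_of_cur_best hq hz] at this
  | succ k ih =>
    have h4 : σ.one = 1 := hσ.2.1
    -- The first sweep is pulled back last, so its slope is the one already reduced by the `k`
    -- sweeps after it.
    have key := haltProb_sweep E hσ hv hp hq hj (target := target)
      (t := t + k * (2 ^ (r + 1) * (24 * r + 240)) + 1 + 3)
      (S := block [.assign 10 .sub 10 4] :: .loop 10 roundBody :: S) (out := out) (A := A)
      (β := (3 / 4) ^ k * β) (by positivity) fun y => by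
        let σ1 : ClState w := { σ with cur := word w y, best := word w y, sc := 0, j := 0 }
        let σ2 : ClState w := { σ1 with rc := BitVec.ofNat w k }
        have s1 : Runs (tableOf w P) (.assign 10 .sub 10 4) 1 ⟨σ1.reg, out, zeroState w⟩
            ⟨σ2.reg, out, zeroState w⟩ :=
          Runs.assign_of 10 .sub 10 4 out _ (by
            simp only [σ2]
            rw [← ofNat_succ_sub_one k, ← hrc, ← h4]
            exact σ1.update_rc _)
        refine le_trans ?_ ((Runs.block_cons s1 (Runs.block_nil _)) target _ _)
        refine ih (by omega) (σ := σ2) hσ hp rfl rfl rfl rfl rfl fun y => ?_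
        have e : ({ σ2 with cur := word w y, best := word w y, rc := 0 } : ClState w) =
            { σ with cur := word w y, best := word w y, rc := 0 } := by
          simp only [σ2, σ1, hsc, hj]
        rw [e]
        exact hg y
    refine le_trans (le_of_eq ?_) (key.trans (((le_of_eq haltProb_block_cons.symm).trans
      (le_loop (x := 10) ?_)).trans (haltProb_mono ?_ _ _)))
    · ring
    · change σ.rc ≠ 0
      rw [hrc]
      exact ofNat_ne_zero (Nat.succ_ne_zero k) hk
    · have : 1 ≤ 2 ^ (r + 1) := Nat.one_le_two_pow
      have e : (k + 1) * (2 ^ (r + 1) * (24 * r + 240)) = k * (2 ^ (r + 1) * (24 * r + 240)) +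
        2 ^ (r + 1) * (24 * r + 230) + 2 ^ (r + 1) * 10 := by ring
      omega

theorem haltProb_search (E : Env w b r R P) {p n : Fin m} (hn : IsClockwiseEdge P p n) {t : ℕ}
    {S : List (Prog 25)} {out : List (BitVec w)} {A : ℝ} (hA : A ≤ 1)
    {σ : ClState w} (hσ : Good m r R σ) (hp : σ.p = word w p) (hj : σ.j = 0) (hsc : σ.sc = 0)
    (hg : A ≤ haltProb (tableOf w P) target t S
      ⟨{ σ with cur := word w n, best := word w n, rc := 0 }.reg, out, zeroState w⟩) :
    A - (3 / 4) ^ R * m ≤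
      haltProb (tableOf w P) target (t + R * (2 ^ (r + 1) * (24 * r + 240)) + 10)
        (search :: S) ⟨σ.reg, out, zeroState w⟩ := by
  let σ1 : ClState w := { σ with cur := word w p }
  let σ2 : ClState w := { σ1 with best := word w p }
  let σ3 : ClState w := { σ2 with rc := BitVec.ofNat w R }
  have s1 : Runs (tableOf w P) (.assign 8 .fst 1 1) 1 ⟨σ.reg, out, zeroState w⟩
      ⟨σ1.reg, out, zeroState w⟩ :=
    Runs.assign_of 8 .fst 1 1 out _ (by simp only [σ1, ← hp]; exact σ.update_cur _)
  have s2 : Runs (tableOf w P) (.assign 9 .fst 1 1) 1 ⟨σ1.reg, out, zeroState w⟩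
      ⟨σ2.reg, out, zeroState w⟩ :=
    Runs.assign_of 9 .fst 1 1 out _ (by simp only [σ2, ← hp]; exact σ1.update_best _)
  have s3 : Runs (tableOf w P) (.assign 10 .fst 20 20) 1 ⟨σ2.reg, out, zeroState w⟩
      ⟨σ3.reg, out, zeroState w⟩ :=
    Runs.assign_of 10 .fst 20 20 out _ (by
      have h20 : σ.rounds = _ := hσ.2.2.2.2.1
      simp only [σ3, ← h20]
      exact σ2.update_rc _)
  have key := haltProb_rounds E hn.2.1 (target := target) (t := t + 1) (S := block [] :: S)
    (out := out) (A := A) zero_le_one R E.rounds (σ := σ3) hσ hp rfl rfl hj hsc rfl fun y => by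
      refine le_trans ?_ (Runs.block_nil _ target S t)
      -- Markov's inequality in disguise: rank `0` means that the neighbour is found, and for rank
      -- at least `1` the bound `A - rank` is nonpositive since `A ≤ 1`.
      rcases Nat.eq_zero_or_pos (beaters P p y).card with h | h
      · have : n = y := isClockwiseEdge_unique E.inj hn fun k hk => by
          have hmem : k ∈ beaters P p y := Finset.mem_filter.2 ⟨Finset.mem_univ k, hk⟩
          rw [Finset.card_eq_zero.1 h] at hmem
          simp at hmem
        subst this
        rw [h]
        simpa using hg
      · have : (1 : ℝ) ≤ (beaters P p y).card := by exact_mod_cast h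
        exact le_trans (by linarith) (haltProb_nonneg _ _ _)
  refine le_trans ?_ (key.trans (((le_of_eq haltProb_block_cons.symm).trans
    (s3.le_block_cons.trans (s2.le_block_cons.trans s1.le_block_cons))).trans
      (haltProb_mono ?_ _ _)))
  · have : ((beaters P p p).card : ℝ) ≤ m := by
      have := Finset.card_le_univ (beaters P p p)
      rw [Fintype.card_fin] at this
      exact_mod_cast this
    have h0 : (0 : ℝ) < (3 / 4) ^ R := by positivity
    nlinarith
  · omega

theorem sum_norm_sq_zeroState : ∑ v, ‖zeroState w v‖ ^ 2 = 1 := by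
  rw [zeroState, embed_single _ base_zero_apply,
    Finset.sum_eq_single (base 0) (fun v _ hv => by rw [Pi.single_eq_of_ne hv]; simp) (by simp)]
  simp

/-- A union bound by induction on the list: each edge loses at most `(3/4) ^ R * m`. The loop flag
is the difference of the current and the final index word, zero exactly at the last vertex, so the
length need not be known. -/
theorem haltProb_walk (E : Env w b r R P) {f : Fin m} (L : List (Fin m)) {p : Fin m}
    (hL : IsClockwisePart P p f L) {out : List (BitVec w)} {σ : ClState w} (hσ : Good m r R σ)
    (hp : σ.p = word w p) (hf : σ.f = word w f) (hfl : σ.flag = word w p - word w f)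
    (hj : σ.j = 0) (hsc : σ.sc = 0) :
    1 - ((L.length : ℝ) - 1) * ((3 / 4) ^ R * m) ≤
      haltProb (tableOf w P) (out ++ L.tail.map (word w))
        ((L.length - 1) * (R * (2 ^ (r + 1) * (24 * r + 240)) + 30) + 1)
        [.loop 7 walkBody] ⟨σ.reg, out, zeroState w⟩ := by
  induction L generalizing p out σ with
  | nil => simp [IsClockwisePart] at hL
  | cons a L ih =>
    have h7 : σ.reg 7 = word w p - word w f := hfl
    by_cases hpf : p = f
    · subst hpf
      rw [isClockwisePart_self_iff hL]
      have hz : (⟨σ.reg, out, zeroState w⟩ : Mem 25 w).reg 7 = 0 := by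
        change σ.reg 7 = 0
        rw [h7]; exact BitVec.sub_self _
      refine le_trans (le_of_eq ?_) (Runs.loop_done (p := walkBody) hz _ [] _)
      rw [haltProb]
      simp [sum_norm_sq_zeroState]
    · obtain ⟨n, L', e, hn, hL'⟩ := isClockwisePart_cases hpf hL
      injection e with e1 e2
      subst e1 e2
      have hlen : 1 ≤ L.length := by
        cases L with
        | nil => simp [IsClockwisePart] at hL'
        | cons => simp
      have hmap : L.map (word w) = word w n :: L.tail.map (word w) := by
        cases L with
        | nil => simp [IsClockwisePart] at hL'
        | cons x L =>
          have := hL'.1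
          simp only [List.head?_cons, Option.some.injEq] at this
          subst this
          rfl
      set δ : ℝ := (3 / 4) ^ R * m with hδ
      have hδ0 : 0 ≤ δ := by positivity
      have hlen' : (1 : ℝ) ≤ L.length := by exact_mod_cast hlen
      set T := R * (2 ^ (r + 1) * (24 * r + 240)) with hT
      let σ1 : ClState w := { σ with cur := word w n, best := word w n, rc := 0 }
      let σ2 : ClState w := { σ1 with p := word w n }
      let σ3 : ClState w := { σ2 with flag := word w n - word w f }
      have s1 : Runs (tableOf w P) (.assign 1 .fst 8 8) 1 ⟨σ1.reg, out, zeroState w⟩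
          ⟨σ2.reg, out, zeroState w⟩ :=
        Runs.assign_of 1 .fst 8 8 out _ (σ1.update_p _)
      have s2 : Runs (tableOf w P) (.emit 1) 1 ⟨σ2.reg, out, zeroState w⟩
          ⟨σ2.reg, out ++ [word w n], zeroState w⟩ := Runs.emit 1 _
      have s3 : Runs (tableOf w P) (.assign 7 .sub 1 2) 1
          ⟨σ2.reg, out ++ [word w n], zeroState w⟩ ⟨σ3.reg, out ++ [word w n], zeroState w⟩ :=
        Runs.assign_of 7 .sub 1 2 _ _ (by simp only [σ3, ← hf]; exact σ2.update_flag _)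
      have h1 := ih hL' (out := out ++ [word w n]) (σ := σ3) hσ rfl hf rfl hj hsc
      rw [List.append_assoc, List.singleton_append, ← hmap] at h1
      have h2 := h1.trans ((Runs.block_cons s1 (Runs.block_cons s2 (Runs.block_cons s3
        (Runs.block_nil _)))) (out ++ L.map (word w)) [.loop 7 walkBody] _)
      have h3 := haltProb_search E hn (A := 1 - ((L.length : ℝ) - 1) * δ)
        (by nlinarith) hσ hp hj hsc h2
      refine le_trans (le_of_eq ?_) (h3.trans (((le_of_eq haltProb_block_cons.symm).trans
        (le_loop (x := 7) ?_)).trans (haltProb_mono ?_ _ _)))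
      · rw [List.length_cons]; push_cast; ring
      · change σ.reg 7 ≠ 0
        rw [h7]
        intro h
        exact hpf (word_injective E.lt_pow.le (sub_eq_zero.1 h))
      · have e : (L.length - 1 + 1) * (T + 30) = (L.length - 1) * (T + 30) + (T + 30) := by ring
        rw [List.length_cons, Nat.add_sub_cancel]
        conv_rhs => rw [← Nat.sub_add_cancel hlen, e]
        omega

end Walk

/-! ### The full program and its initialization -/

section Main

variable {w m : ℕ} {P : Fin m → ℤ × ℤ} {D : Table w}

/-- Multiply the size of the index space by four. -/
def sizeBody : Prog 25 :=
  block [.assign 6 .add 6 6, .assign 6 .add 6 6, .assign 5 .add 5 4, .assign 7 .ult 6 0]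

/-- Set up the constants, and output the first vertex. -/
def setup (c : ℕ) : Prog 25 :=
  block [.assign 4 (.lit 1) 3 3, .assign 6 (.lit 1) 3 3, .assign 7 .ult 6 0, .loop 7 sizeBody,
    .assign 17 .add 5 5, .assign 18 (.lit (5 * (c + 3))) 3 3, .assign 19 .add 5 4,
    .assign 20 .mul 19 18, .emit 1, .assign 7 .sub 1 2]

/-- The program that outputs the clockwise part of the convex hull. -/
def hullProg (c : ℕ) : Prog 25 := .seq (setup c) (.loop 7 walkBody)

/-- The initial contents of the registers. -/
def initState (w m s f : ℕ) : ClState w where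
  m := BitVec.ofNat w m
  p := BitVec.ofNat w s
  f := BitVec.ofNat w f
  one := 0
  n := 0
  size := 0
  flag := 0
  cur := 0
  best := 0
  rc := 0
  sc := 0
  j := 0
  jc := 0
  hc := 0
  x := 0
  fl := 0
  bits := 0
  lit := 0
  scales := 0
  rounds := 0

theorem initMem_eq (s f : ℕ) :
    initMem 25 w m s f = ⟨(initState w m s f).reg, [], zeroState w⟩ := by
  unfold initMem
  congr 1
  · funext x
    by_cases h0 : x = 0
    · subst h0; rfl
    by_cases h1 : x = 1
    · subst h1; rfl
    by_cases h2 : x = 2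
    · subst h2; rfl
    rw [if_neg h0, if_neg h1, if_neg h2]
    unfold ClState.reg
    split <;> first | rfl | contradiction
  · funext v
    rw [zeroState, embed_single _ base_zero_apply, Pi.single_apply]
    have : (base 0 : Basis 25 w) = 0 := by simp [base]
    rw [this]

/-- Powers of four are generated until one is at least `m`; `4 ^ r < 2 ^ w` excludes overflow on the
way. -/
theorem runs_setup {r : ℕ} (hr : r = Nat.clog 4 m) (h4 : 4 ^ r < 2 ^ w) (hm : m < 2 ^ w)
    (c s f : ℕ) :
    ∃ σ : ClState w, Good m r (5 * (c + 3) * (r + 1)) σ ∧ σ.p = BitVec.ofNat w s ∧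
      σ.f = BitVec.ofNat w f ∧ σ.flag = BitVec.ofNat w s - BitVec.ofNat w f ∧ σ.j = 0 ∧
      σ.sc = 0 ∧
      Runs (tableOf w P) (setup c) (r * 10 + 30) ⟨(initState w m s f).reg, [], zeroState w⟩
        ⟨σ.reg, [BitVec.ofNat w s], zeroState w⟩ := by
  let σ0 : ClState w := initState w m s f
  let σ1 : ClState w := { σ0 with one := 1 }
  let σ2 : ClState w := { σ1 with size := 1 }
  let τ : ℕ → ClState w := fun i => { σ1 with
    n := BitVec.ofNat w i
    size := BitVec.ofNat w (4 ^ i)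
    flag := if 4 ^ i < m then 1 else 0 }
  have hlt : ∀ i ≤ r, 4 ^ i < 2 ^ w := fun i hi =>
    (Nat.pow_le_pow_right (by norm_num) hi).trans_lt h4
  have hflag : ∀ i ≤ r, WordOp.ult.eval (tableOf w P) (BitVec.ofNat w (4 ^ i))
      (BitVec.ofNat w m) = if 4 ^ i < m then 1 else 0 := fun i hi => by
    simp only [WordOp.eval, BitVec.toNat_ofNat, Nat.mod_eq_of_lt (hlt i hi), Nat.mod_eq_of_lt hm]
  have s1 : Runs (tableOf w P) (.assign 4 (.lit 1) 3 3) 1 ⟨σ0.reg, [], zeroState w⟩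
      ⟨σ1.reg, [], zeroState w⟩ := Runs.assign_of 4 (.lit 1) 3 3 _ _ (σ0.update_one _)
  have s2 : Runs (tableOf w P) (.assign 6 (.lit 1) 3 3) 1 ⟨σ1.reg, [], zeroState w⟩
      ⟨σ2.reg, [], zeroState w⟩ := Runs.assign_of 6 (.lit 1) 3 3 _ _ (σ1.update_size _)
  have s3 : Runs (tableOf w P) (.assign 7 .ult 6 0) 1 ⟨σ2.reg, [], zeroState w⟩
      ⟨(τ 0).reg, [], zeroState w⟩ := Runs.assign_of 7 .ult 6 0 _ _ (by
    simp only [τ]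
    rw [← hflag 0 (Nat.zero_le r)]
    exact σ2.update_flag _)
  have s4 := Runs.loop_count (D := tableOf w P) (x := 7) (p := sizeBody) (T := 9) (n := r)
    (ν := fun k => ⟨(τ (r - k)).reg, [], zeroState w⟩) (by
      change (if 4 ^ (r - 0) < m then 1 else 0 : BitVec w) = 0
      rw [if_neg]
      rw [not_lt, Nat.sub_zero, hr]
      exact Nat.le_pow_clog (by norm_num) m) fun k hk => by
    refine ⟨?_, ?_⟩
    · change (if 4 ^ (r - (k + 1)) < m then 1 else 0 : BitVec w) ≠ 0
      rw [if_pos (Nat.pow_lt_of_lt_clog (by omega))]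
      exact ofNat_ne_zero one_ne_zero (lt_of_le_of_lt Nat.one_le_two_pow
        ((show 2 ^ (2 * r) = 4 ^ r by rw [pow_mul]; norm_num) ▸ h4))
    · obtain ⟨i, hi, hi'⟩ : ∃ i, r - (k + 1) = i ∧ r - k = i + 1 := ⟨_, rfl, by omega⟩
      simp only [hi, hi']
      let τ1 : ClState w := { τ i with size := BitVec.ofNat w (2 * 4 ^ i) }
      let τ2 : ClState w := { τ i with size := BitVec.ofNat w (4 ^ (i + 1)) }
      let τ3 : ClState w := { τ2 with n := BitVec.ofNat w (i + 1) }
      have g1 : Runs (tableOf w P) (.assign 6 .add 6 6) 1 ⟨(τ i).reg, [], zeroState w⟩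
          ⟨τ1.reg, [], zeroState w⟩ := Runs.assign_of 6 .add 6 6 _ _ (by
        simp only [τ1]
        rw [two_mul, BitVec.ofNat_add]
        exact (τ i).update_size _)
      have g2 : Runs (tableOf w P) (.assign 6 .add 6 6) 1 ⟨τ1.reg, [], zeroState w⟩
          ⟨τ2.reg, [], zeroState w⟩ := Runs.assign_of 6 .add 6 6 _ _ (by
        simp only [τ2]
        rw [show 4 ^ (i + 1) = 2 * 4 ^ i + 2 * 4 ^ i by rw [pow_succ]; ring, BitVec.ofNat_add]
        exact τ1.update_size _)
      have g3 : Runs (tableOf w P) (.assign 5 .add 5 4) 1 ⟨τ2.reg, [], zeroState w⟩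
          ⟨τ3.reg, [], zeroState w⟩ := Runs.assign_of 5 .add 5 4 _ _ (by
        simp only [τ3]
        rw [BitVec.ofNat_add]
        exact τ2.update_n _)
      have g4 : Runs (tableOf w P) (.assign 7 .ult 6 0) 1 ⟨τ3.reg, [], zeroState w⟩
          ⟨(τ (i + 1)).reg, [], zeroState w⟩ := Runs.assign_of 7 .ult 6 0 _ _ (by
        simp only [τ]
        rw [← hflag (i + 1) (by omega)]
        exact τ3.update_flag _)
      exact Runs.block_cons g1 (Runs.block_cons g2 (Runs.block_cons g3 (Runs.block_cons g4
        (Runs.block_nil _))))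
  simp only [Nat.sub_self, Nat.sub_zero] at s4
  let σ5 : ClState w := { τ r with bits := BitVec.ofNat w (2 * r) }
  let σ6 : ClState w := { σ5 with lit := BitVec.ofNat w (5 * (c + 3)) }
  let σ7 : ClState w := { σ6 with scales := BitVec.ofNat w (r + 1) }
  let σ8 : ClState w := { σ7 with rounds := BitVec.ofNat w (5 * (c + 3) * (r + 1)) }
  let σ9 : ClState w := { σ8 with flag := BitVec.ofNat w s - BitVec.ofNat w f }
  have s5 : Runs (tableOf w P) (.assign 17 .add 5 5) 1 ⟨(τ r).reg, [], zeroState w⟩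
      ⟨σ5.reg, [], zeroState w⟩ := Runs.assign_of 17 .add 5 5 _ _ (by
    simp only [σ5]
    rw [two_mul, BitVec.ofNat_add]
    exact (τ r).update_bits _)
  have s6 : Runs (tableOf w P) (.assign 18 (.lit (5 * (c + 3))) 3 3) 1 ⟨σ5.reg, [], zeroState w⟩
      ⟨σ6.reg, [], zeroState w⟩ := Runs.assign_of 18 (.lit (5 * (c + 3))) 3 3 _ _ (σ5.update_lit _)
  have s7 : Runs (tableOf w P) (.assign 19 .add 5 4) 1 ⟨σ6.reg, [], zeroState w⟩
      ⟨σ7.reg, [], zeroState w⟩ := Runs.assign_of 19 .add 5 4 _ _ (by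
    simp only [σ7]
    rw [BitVec.ofNat_add]
    exact σ6.update_scales _)
  have s8 : Runs (tableOf w P) (.assign 20 .mul 19 18) 1 ⟨σ7.reg, [], zeroState w⟩
      ⟨σ8.reg, [], zeroState w⟩ := Runs.assign_of 20 .mul 19 18 _ _ (by
    simp only [σ8]
    rw [mul_comm (5 * (c + 3)), BitVec.ofNat_mul]
    exact σ7.update_rounds _)
  have s9 : Runs (tableOf w P) (.emit 1) 1 ⟨σ8.reg, [], zeroState w⟩
      ⟨σ8.reg, [BitVec.ofNat w s], zeroState w⟩ := Runs.emit 1 _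
  have s10 : Runs (tableOf w P) (.assign 7 .sub 1 2) 1 ⟨σ8.reg, [BitVec.ofNat w s], zeroState w⟩
      ⟨σ9.reg, [BitVec.ofNat w s], zeroState w⟩ :=
    Runs.assign_of 7 .sub 1 2 _ _ (σ8.update_flag _)
  refine ⟨σ9, ⟨rfl, rfl, rfl, rfl, rfl, rfl, rfl, rfl, rfl⟩, rfl, rfl, rfl, rfl, rfl, ?_⟩
  refine (Runs.block_cons s1 (Runs.block_cons s2 (Runs.block_cons s3 (Runs.block_cons s4
    (Runs.block_cons s5 (Runs.block_cons s6 (Runs.block_cons s7 (Runs.block_cons s8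
      (Runs.block_cons s9 (Runs.block_cons s10 (Runs.block_nil _))))))))))).mono ?_
  omega

end Main

/-! ### Numerical estimates for word length, error and running time -/

section Bounds

theorem two_pow_clog_le {m : ℕ} (hm : 1 ≤ m) : (2 : ℝ) ^ Nat.clog 4 m ≤ 2 * √(m : ℝ) := by
  have h : (4 : ℝ) ^ Nat.clog 4 m ≤ 4 * m := by
    rcases Nat.eq_zero_or_pos (Nat.clog 4 m) with h0 | h0
    · rw [h0, pow_zero]
      have : (1 : ℝ) ≤ m := by exact_mod_cast hm
      linarith
    · have hm1 : 1 < m := by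
        by_contra h
        rw [show m = 1 by omega, Nat.clog_one_right] at h0
        omega
      have h1 := Nat.pow_pred_clog_lt_self (b := 4) (by norm_num) hm1
      have h2 : 4 ^ Nat.clog 4 m = 4 * 4 ^ (Nat.clog 4 m).pred := by
        rw [← pow_succ', Nat.pred_eq_sub_one, Nat.sub_add_cancel h0]
      have : 4 ^ Nat.clog 4 m ≤ 4 * m := by omega
      exact_mod_cast this
  rw [show 2 * √(m : ℝ) = √(4 * m) by
    rw [Real.sqrt_mul (by norm_num), show (4 : ℝ) = 2 ^ 2 by norm_num, Real.sqrt_sq (by norm_num)]]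
  refine Real.le_sqrt_of_sq_le ?_
  rw [← pow_mul, mul_comm, pow_mul]
  norm_num
  exact h

theorem clog_add_one_le {m : ℕ} (hm : 1 ≤ m) :
    ((Nat.clog 4 m : ℕ) : ℝ) + 1 ≤ 2 * (Real.log m + 1) := by
  have hm' : (1 : ℝ) ≤ m := by exact_mod_cast hm
  have hlog : 0 ≤ Real.log m := Real.log_nonneg hm'
  rcases Nat.eq_zero_or_pos (Nat.clog 4 m) with h0 | h0
  · rw [h0, Nat.cast_zero]; linarith
  · have hm1 : 1 < m := by
      by_contra h
      rw [show m = 1 by omega, Nat.clog_one_right] at h0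
      omega
    have h1 : (4 : ℝ) ^ (Nat.clog 4 m - 1) ≤ m := by
      exact_mod_cast (Nat.pow_pred_clog_lt_self (b := 4) (by norm_num) hm1).le
    have h2 := Real.log_le_log (by positivity) h1
    rw [Real.log_pow] at h2
    have h4 : 1 ≤ Real.log 4 := by
      rw [Real.le_log_iff_exp_le (by norm_num)]
      linarith [Real.exp_one_lt_d9]
    have h3 : ((Nat.clog 4 m - 1 : ℕ) : ℝ) ≤ Real.log m := by
      have := mul_le_mul_of_nonneg_left h4 (Nat.cast_nonneg (α := ℝ) (Nat.clog 4 m - 1))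
      linarith
    rw [Nat.cast_sub h0, Nat.cast_one] at h3
    linarith

/-- Five sweeps gain a factor of four, since `(3/4) ^ 5 < 1/4`, and `m + 1 ≤ 4 ^ (r + 1)`. -/
theorem three_quarters_pow_le (c m : ℕ) :
    (3 / 4 : ℝ) ^ (5 * (c + 3) * (Nat.clog 4 m + 1)) ≤ 1 / ((m : ℝ) + 1) ^ (c + 3) := by
  set r := Nat.clog 4 m with hr
  have h1 : (m : ℝ) + 1 ≤ 4 ^ (r + 1) := by
    have h2 : m ≤ 4 ^ r := Nat.le_pow_clog (by norm_num) m
    have h3 : m + 1 ≤ 4 ^ (r + 1) := by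
      have := Nat.one_le_pow r 4 (by norm_num)
      rw [pow_succ]
      omega
    exact_mod_cast h3
  calc (3 / 4 : ℝ) ^ (5 * (c + 3) * (r + 1)) = ((3 / 4 : ℝ) ^ 5) ^ ((r + 1) * (c + 3)) := by
        rw [← pow_mul]; congr 1; ring
    _ ≤ (1 / 4 : ℝ) ^ ((r + 1) * (c + 3)) := by gcongr; norm_num
    _ = 1 / ((4 : ℝ) ^ (r + 1)) ^ (c + 3) := by rw [one_div_pow, pow_mul]
    _ ≤ 1 / ((m : ℝ) + 1) ^ (c + 3) := by gcongr

theorem env_of_le {c m b w : ℕ} {P : Fin m → ℤ × ℤ} (hP : Function.Injective P)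
    (hb : ∀ i, |(P i).1| < 2 ^ b ∧ |(P i).2| < 2 ^ b) (hm : 1 ≤ m)
    (hw : (5 * c + 20) * (b + Nat.log 2 m + 1) ≤ w) :
    4 ^ Nat.clog 4 m < 2 ^ w ∧ Env w b (Nat.clog 4 m) (5 * (c + 3) * (Nat.clog 4 m + 1)) P := by
  set r := Nat.clog 4 m with hr
  set l := Nat.log 2 m with hl
  have hw1 : 5 * c + 20 * (b + l + 1) ≤ w := by nlinarith
  have hml : m < 2 ^ (l + 1) := Nat.lt_pow_succ_log_self (by norm_num) m
  have hle : m ≤ 4 ^ r := Nat.le_pow_clog (by norm_num) m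
  have h4 : (4 : ℕ) ^ r = 2 ^ (2 * r) := by rw [pow_mul]; norm_num
  have hrl : 2 * r < l + 3 := by
    rcases Nat.eq_zero_or_pos r with h0 | h0
    · omega
    · have hm1 : 1 < m := by
        by_contra h
        rw [hr, show m = 1 by omega, Nat.clog_one_right] at h0
        omega
      have h1 : 4 ^ (r - 1) < m := Nat.pow_pred_clog_lt_self (by norm_num) hm1
      have h2 : (2 : ℕ) ^ (2 * (r - 1)) < 2 ^ (l + 1) := by
        rw [pow_mul]; norm_num; omega
      have := (Nat.pow_lt_pow_iff_right (by norm_num : 1 < 2)).1 h2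
      omega
  refine ⟨?_, hP, hb, ?_, by omega, ?_, by omega, by omega, ?_⟩
  · rw [h4]
    exact Nat.pow_lt_pow_right (by norm_num) (by omega)
  · exact hml.trans_le (Nat.pow_le_pow_right (by norm_num) (by omega))
  · rw [← h4]
    exact hle
  · calc 5 * (c + 3) * (r + 1) < 2 ^ (5 * (c + 3)) * 2 ^ (r + 1) :=
        mul_lt_mul'' Nat.lt_two_pow_self Nat.lt_two_pow_self (Nat.zero_le _) (Nat.zero_le _)
      _ = 2 ^ (5 * (c + 3) + (r + 1)) := (pow_add _ _ _).symm
      _ ≤ 2 ^ w := Nat.pow_le_pow_right (by norm_num) (by omega)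

/-- One logarithm comes from the number of rounds, the other from the Hadamard gates in each Grover
iteration. The factor `8` is `2` from `2 ^ r ≤ 2 * √m` times `2 ^ 2` from `r + 1 ≤ 2 * (log m + 1)`.
-/
theorem cost_le {c m h : ℕ} (hm : 1 ≤ m) (hh : 1 ≤ h) :
    (h - 1) * (5 * (c + 3) * (Nat.clog 4 m + 1) *
        (2 ^ (Nat.clog 4 m + 1) * (24 * Nat.clog 4 m + 240)) + 30) + 1 +
        (Nat.clog 4 m * 10 + 30) + 1 ≤
      ⌊((8 * (2400 * (c + 3) + 80) : ℕ) : ℝ) * (h : ℝ) * √(m : ℝ) * (Real.log m + 1) ^ 2⌋₊ := by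
  have hX := two_pow_clog_le hm
  have hy := clog_add_one_le hm
  set r := Nat.clog 4 m with hr
  refine Nat.le_floor ?_
  have hnat : (h - 1) * (5 * (c + 3) * (r + 1) * (2 ^ (r + 1) * (24 * r + 240)) + 30) + 1 +
      (r * 10 + 30) + 1 ≤ (2400 * (c + 3) + 80) * (h * (2 ^ r * (r + 1) ^ 2)) := by
    have hX1 : 1 ≤ 2 ^ r := Nat.one_le_two_pow
    have h1 : 5 * (c + 3) * (r + 1) * (2 ^ (r + 1) * (24 * r + 240)) ≤
        2400 * (c + 3) * (2 ^ r * (r + 1) ^ 2) := by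
      rw [pow_succ]
      calc 5 * (c + 3) * (r + 1) * (2 ^ r * 2 * (24 * r + 240))
          ≤ 5 * (c + 3) * (r + 1) * (2 ^ r * 2 * (240 * (r + 1))) := by gcongr; omega
        _ = 2400 * (c + 3) * (2 ^ r * (r + 1) ^ 2) := by ring
    have h2 : 1 ≤ 2 ^ r * (r + 1) ^ 2 := Nat.mul_pos (by omega) (by positivity)
    have h3 : r + 1 ≤ 2 ^ r * (r + 1) ^ 2 := by nlinarith [Nat.zero_le r]
    set Y := 2 ^ r * (r + 1) ^ 2
    have h4 : Y ≤ h * Y := Nat.le_mul_of_pos_left _ hh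
    calc (h - 1) * (5 * (c + 3) * (r + 1) * (2 ^ (r + 1) * (24 * r + 240)) + 30) + 1 +
          (r * 10 + 30) + 1
        ≤ h * (2400 * (c + 3) * Y + 30 * Y) + 40 * (h * Y) := by
          have : (h - 1) * (5 * (c + 3) * (r + 1) * (2 ^ (r + 1) * (24 * r + 240)) + 30) ≤
              (h - 1) * (2400 * (c + 3) * Y + 30 * Y) := Nat.mul_le_mul_left _ (by omega)
          have e : h * (2400 * (c + 3) * Y + 30 * Y) = (h - 1) * (2400 * (c + 3) * Y + 30 * Y) +
              (2400 * (c + 3) * Y + 30 * Y) := by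
            conv_lhs => rw [← Nat.sub_add_cancel hh]
            ring
          omega
      _ ≤ (2400 * (c + 3) + 80) * (h * Y) := by nlinarith
  refine (Nat.cast_le (α := ℝ) |>.2 hnat).trans ?_
  push_cast
  have hm' : (1 : ℝ) ≤ m := by exact_mod_cast hm
  have hlog : 0 ≤ Real.log m := Real.log_nonneg hm'
  calc (2400 * ((c : ℝ) + 3) + 80) * (h * (2 ^ r * (r + 1) ^ 2))
      ≤ (2400 * ((c : ℝ) + 3) + 80) * (h * ((2 * √(m : ℝ)) * (2 * (Real.log m + 1)) ^ 2)) := by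
        gcongr
    _ = 8 * (2400 * ((c : ℝ) + 3) + 80) * h * √(m : ℝ) * (Real.log m + 1) ^ 2 := by ring

end Bounds

/-! ### The main theorem -/

theorem mainTheorem3 (c : ℕ) :
    ∃ (K : ℕ) (p : Prog K) (κ C k : ℕ),
      ∀ (m b w : ℕ) (P : Fin m → ℤ × ℤ) (s f : Fin m),
        Function.Injective P →
        (∀ i, |(P i).1| < 2 ^ b ∧ |(P i).2| < 2 ^ b) →
        κ * (b + Nat.log 2 m + 1) ≤ w →
        IsHullVertex P s → IsHullVertex P f →
        (∃! L : List (Fin m), IsClockwisePart P s f L) ∧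
        ∀ L : List (Fin m), IsClockwisePart P s f L →
          1 - 1 / ((m : ℝ) + 1) ^ c ≤
            outputProb p w P s f L
              ⌊(C : ℝ) * (L.length : ℝ) * √(m : ℝ) * (Real.log m + 1) ^ k⌋₊ := by
  refine ⟨25, hullProg c, 5 * c + 20, 8 * (2400 * (c + 3) + 80), 2, ?_⟩
  intro m b w P s f hP hb hw hs hf
  have hm : 1 ≤ m := (Nat.zero_le _).trans_lt s.2
  refine ⟨?_, fun L hL => ?_⟩
  · obtain ⟨L, hL⟩ := exists_isClockwisePart hP hs hf
    exact ⟨L, hL, fun L' hL' => isClockwisePart_unique hP hL' hL⟩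
  obtain ⟨h4, E⟩ := env_of_le hP hb hm hw
  obtain ⟨σ, hσ, hp, hfin, hfl, hj, hsc, hrun⟩ := runs_setup (P := P) rfl h4 E.lt_pow c s f
  have hlen : 1 ≤ L.length := by
    cases L with
    | nil => simp [IsClockwisePart] at hL
    | cons => simp
  have hLm : L.length ≤ m := by simpa using hL.2.2.1.length_le_card
  have hmap : [word w s] ++ L.tail.map (word w) = L.map fun i : Fin m => BitVec.ofNat w (i : ℕ) := by
    cases L with
    | nil => simp [IsClockwisePart] at hL
    | cons x L =>
      have := hL.1
      simp only [List.head?_cons, Option.some.injEq] at this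
      subst this
      rfl
  have h1 := haltProb_walk E L hL (out := [word w s]) hσ hp hfin hfl hj hsc
  rw [hmap] at h1
  have h2 := h1.trans (hrun _ [.loop 7 walkBody] _)
  refine le_trans ?_ (h2.trans (le_trans (le_of_eq ?_) (haltProb_mono (cost_le hm hlen) _ _)))
  · have h3 := three_quarters_pow_le c m
    have hm0 : (0 : ℝ) ≤ m := Nat.cast_nonneg m
    have hL1 : (1 : ℝ) ≤ L.length := by exact_mod_cast hlen
    have hL2 : (L.length : ℝ) - 1 ≤ m + 1 := by
      have : (L.length : ℝ) ≤ m := by exact_mod_cast hLm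
      linarith
    -- Of the exponent `c + 3`, one power pays for the number of edges and one for the initial rank;
    -- the third is slack.
    have h5 : ((L.length : ℝ) - 1) *
        ((3 / 4) ^ (5 * (c + 3) * (Nat.clog 4 m + 1)) * m) ≤ 1 / ((m : ℝ) + 1) ^ c := by
      calc ((L.length : ℝ) - 1) * ((3 / 4) ^ (5 * (c + 3) * (Nat.clog 4 m + 1)) * m)
          ≤ (m + 1) * (1 / ((m : ℝ) + 1) ^ (c + 3) * (m + 1)) := by
            refine mul_le_mul hL2 (mul_le_mul h3 (by linarith) hm0 (by positivity))
              (by positivity) (by positivity)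
        _ = 1 / ((m : ℝ) + 1) ^ c * (1 / ((m : ℝ) + 1)) := by
            rw [pow_add]; field_simp
        _ ≤ 1 / ((m : ℝ) + 1) ^ c * 1 := by
            refine mul_le_mul_of_nonneg_left ?_ (by positivity)
            rw [div_le_one (by positivity)]
            linarith
        _ = 1 / ((m : ℝ) + 1) ^ c := mul_one _
    linarith
  · rw [initMem_eq, hullProg]
    conv_rhs => rw [haltProb]
    congr 1
    simp [← List.map_eq_flatMap, Function.comp_def]
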